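/- \textbf{Model.} There are $M$ arms and $K\ge 1$ plays, a probing budget $1\le I\le M$, and a non-decreasing overhead function $\alpha:\{0,\dots,I\}\to[0,1]$ with $\alpha(0)=0$, $\alpha(I)=1$. In each round $t=1,\dots,T$ nature draws, independently over rounds, arms and plays, and independently of each other, resources $D_{t,m}\in\{1,\dots,D_{\max}\}$ with law $p_m$ and rewards $X_{t,m,k}\in[0,1]$ with law $\nu_{m,k}$ and mean $\mu_{m,k}$. The learner chooses a set $S_t$ of at most $I$ arms to probe, sees $D_{t,m}$ and $(X_{t,m,k})_k$ for $m\in S_t$, and then assigns each play to at most one arm; $C_{t,m}$ is the set of plays assigned to arm $m$. For real numbers $x_k$ let $\mathrm{top}_n(x;C)$ be the sum of the $\min(n,|C|)$ largest of the $x_k$, $k\in C$. The total reward of the round is $$\mathcal R_t^{\rm total}=(1-\alpha(|S_t|))\Big(\sum_{m\in S_t}\mathrm{top}_{D_{t,m}}(X_{t,m,\cdot};C_{t,m})+\sum_{m\notin S_t}\sum_{d=1}^{D_{\max}}p_m(d)\,\mathrm{top}_{d}(\mu_{m,\cdot};C_{t,m})\Big).$$ On each arm, units of resource go first to the assigned plays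 with the largest $X_{t,m,k}$ (probed arms) or the largest $\mu_{m,k}$ (other arms), ties being broken by the index $k$. After the assignment the learner also sees $D_{t,m}$ for every arm to which a play was assigned and $X_{t,m,k}$ for every assigned play that received a unit of resource. An online algorithm is any (possibly randomized) measurable rule for $S_t$ and for the assignment based on what was seen so far. It may depend on $M,K,D_{\max},I,\alpha,T$ and the $p_m$, but not on the $\nu_{m,k}$. For $S\subseteq\{1,\dots,M\}$ with $|S|\le I$ let $R(S)=(1-\alpha(|S|))f(S)$, where $f(S)$ is the expectation, over the values seen by probing $S$, of the maximum over all assignments of the bracket above (with $S$ in place of $S_t$). Let $R(S^\star)=\max_{|S|\le I}R(S)$, and let the regret be $$\mathcal R_{\rm regret}(T)=\sum_{t=1}^T R(S^\star)-\sum_{t=1}^T\mathcal R_t^{\rm total}.$$ \textbf{Theorem (Lower Bound for Regret).} For every $M\ge 2$ there is a constant $c>0$, depending only on $M$, such that for all $K$, $D_{\max}$, $I$, $\alpha$ as above, all resource laws $p_m$ on $\{1,\dots,D_{\max}\}$, every horizon $T\ge1$ and every online algorithm, there are reward distributions $\nu_{m,k}$ on $[0,1]$ for which $\mathcal R_{\rm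 regret}(T)$ is integrable and $$\mathbb E[\mathcal R_{\rm regret}(T)]\ \ge\ c\sqrt T .$$ -/

import Mathlib

open MeasureTheory

namespace PUCS

/-- What nature draws in one round: the resource `D m` of every arm and the reward `X m k` of every
arm-play pair. -/
abbrev Outcome (M K : ℕ) : Type := (Fin M → ℕ) × (Fin M → Fin K → ℝ)

/-- What probing reveals: for a probed arm its resource and its reward vector, and `Sum.inl ()`
for an arm that is not probed. -/
abbrev ProbeObs (M K : ℕ) : Type := Fin M → Unit ⊕ (ℕ × (Fin K → ℝ))

/-- What playing reveals: the resource of each arm that was assigned at least one play, and the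
reward of each arm-play pair for which the play was assigned to the arm and received a unit of
resource; everything else is `Sum.inl ()`. -/
abbrev PlayObs (M K : ℕ) : Type := (Fin M → Unit ⊕ ℕ) × (Fin M → Fin K → Unit ⊕ ℝ)

/-- Everything the learner sees in one round. -/
abbrev Feedback (M K : ℕ) : Type := ProbeObs M K × PlayObs M K

/-- An action profile: every play is assigned to at most one arm. -/
abbrev Assignment (M K : ℕ) : Type := Fin K → Option (Fin M)

/-- The set `C m` of plays assigned to arm `m`. -/
def plays {M K : ℕ} (C : Assignment M K) (m : Fin M) : Finset (Fin K) :=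
  Finset.univ.filter (fun k => C k = some m)

/-- The plays of `C` that get a unit of resource when `n` units are available and plays with a larger
`key` have priority (ties are broken by the index): the first `min n |C|` plays of `C` in the order
of decreasing `key`. -/
noncomputable def served {K : ℕ} (key : Fin K → ℝ) (C : Finset (Fin K)) (n : ℕ) :
    Finset (Fin K) := by
  classical
  exact C.filter
    (fun k => (C.filter (fun j => key k < key j ∨ (key j = key k ∧ j < k))).card < n)

/-- The sum of the `min n |C|` largest of the numbers `x k`, `k ∈ C`. -/
noncomputable def topSum {K : ℕ} (x : Fin K → ℝ) (C : Finset (Fin K)) (n : ℕ) : ℝ :=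
  ∑ k ∈ served x C n, x k

/-- The reward means `μ m k`. -/
noncomputable def mean {M K : ℕ} (ν : Fin M → Fin K → ProbabilityMeasure ℝ) (m : Fin M)
    (k : Fin K) : ℝ :=
  ∫ x, x ∂(ν m k : Measure ℝ)

/-- The expected total reward of an arm that is not probed, with reward means `μ`, resource law `p`
and assigned plays `C`. -/
noncomputable def unprobedReward {K : ℕ} (Dmax : ℕ) (p : PMF ℕ) (μ : Fin K → ℝ)
    (C : Finset (Fin K)) : ℝ :=
  ∑ d ∈ Finset.Icc 1 Dmax, (p d).toReal * topSum μ C d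

/-- The total reward in a round, before the probing overhead is deducted: arms in `S` are probed
and contribute their realized reward, the others contribute their expected reward. -/
noncomputable def grossReward {M K : ℕ} (Dmax : ℕ) (p : Fin M → PMF ℕ)
    (ν : Fin M → Fin K → ProbabilityMeasure ℝ) (S : Finset (Fin M)) (w : Outcome M K)
    (C : Assignment M K) : ℝ :=
  ∑ m ∈ S, topSum (w.2 m) (plays C m) (w.1 m)
    + ∑ m ∈ Sᶜ, unprobedReward Dmax (p m) (mean ν m) (plays C m)

/-- The total reward `(1 - α(|S|)) (⋯)` of a round. -/
noncomputable def totalReward {M K : ℕ} (Dmax : ℕ) (α : ℕ → ℝ) (p : Fin M → PMF ℕ)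
    (ν : Fin M → Fin K → ProbabilityMeasure ℝ) (S : Finset (Fin M)) (w : Outcome M K)
    (C : Assignment M K) : ℝ :=
  (1 - α S.card) * grossReward Dmax p ν S w C

/-- The law of a round: all resources and all rewards are independent, with laws `p m`, `ν m k`. -/
noncomputable def outcomeLaw {M K : ℕ} (p : Fin M → PMF ℕ)
    (ν : Fin M → Fin K → ProbabilityMeasure ℝ) : Measure (Outcome M K) :=
  (Measure.pi fun m => (p m).toMeasure).prod
    (Measure.pi fun m => Measure.pi fun k => (ν m k : Measure ℝ))

/-- The value of the best assignment given the probing set and the probed values. -/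
noncomputable def hTotal {M K : ℕ} (Dmax : ℕ) (p : Fin M → PMF ℕ)
    (ν : Fin M → Fin K → ProbabilityMeasure ℝ) (S : Finset (Fin M)) (w : Outcome M K) : ℝ :=
  (Finset.univ : Finset (Assignment M K)).sup' Finset.univ_nonempty (grossReward Dmax p ν S w)

/-- `R(S) = (1 - α(|S|)) f(S)`, where `f(S) = E[h_total(S)]`. -/
noncomputable def probingValue {M K : ℕ} (Dmax : ℕ) (α : ℕ → ℝ) (p : Fin M → PMF ℕ)
    (ν : Fin M → Fin K → ProbabilityMeasure ℝ) (S : Finset (Fin M)) : ℝ :=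
  (1 - α S.card) * ∫ w, hTotal Dmax p ν S w ∂(outcomeLaw p ν)

/-- `R(S⋆)`, the largest `R(S)` over the probing sets of at most `I` arms. -/
noncomputable def optimalValue {M K : ℕ} (Dmax I : ℕ) (α : ℕ → ℝ) (p : Fin M → PMF ℕ)
    (ν : Fin M → Fin K → ProbabilityMeasure ℝ) : ℝ :=
  ((Finset.univ : Finset (Finset (Fin M))).filter (fun S => S.card ≤ I)).sup'
    ⟨∅, by simp⟩ (probingValue Dmax α p ν)

/-- The observation after probing `S`. -/
def probeObs {M K : ℕ} (S : Finset (Fin M)) (w : Outcome M K) : ProbeObs M K :=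
  fun m => if m ∈ S then Sum.inr (w.1 m, w.2 m) else Sum.inl ()

/-- The observation after probing `S` and playing `C`. On probed arms the priority among plays is by
realized reward, on the others by mean reward. -/
noncomputable def playObs {M K : ℕ} (ν : Fin M → Fin K → ProbabilityMeasure ℝ)
    (S : Finset (Fin M)) (w : Outcome M K) (C : Assignment M K) : PlayObs M K :=
  (fun m => if (plays C m).Nonempty then Sum.inr (w.1 m) else Sum.inl (),
   fun m k =>
    if k ∈ served (if m ∈ S then w.2 m else mean ν m) (plays C m) (w.1 m)
    then Sum.inr (w.2 m k) else Sum.inl ())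

/-- A (possibly randomized) online algorithm with probing budget `I`. In each round `t` (numbered
from `0`) it first chooses the set of arms to probe, from its internal randomness and the feedback of
the earlier rounds, and then, having also seen the result of the probing, the assignment. -/
structure OnlineAlgorithm (M K I : ℕ) (Seed : Type*) [MeasurableSpace Seed] where
  probe : (t : ℕ) → Seed → (Fin t → Feedback M K) → Finset (Fin M)
  assign : (t : ℕ) → Seed → (Fin t → Feedback M K) → ProbeObs M K → Assignment M K
  card_probe_le : ∀ t u h, (probe t u h).card ≤ I
  measurable_probe : ∀ t S,
    MeasurableSet {x : Seed × (Fin t → Feedback M K) | probe t x.1 x.2 = S}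
  measurable_assign : ∀ t C,
    MeasurableSet {x : Seed × (Fin t → Feedback M K) × ProbeObs M K |
      assign t x.1 x.2.1 x.2.2 = C}

namespace OnlineAlgorithm

variable {M K I : ℕ} {Seed : Type*} [MeasurableSpace Seed]

/-- The assignment made in round `t` with history `h` when nature draws `w`. -/
def action (A : OnlineAlgorithm M K I Seed) (t : ℕ) (u : Seed) (h : Fin t → Feedback M K)
    (w : Outcome M K) : Assignment M K :=
  A.assign t u h (probeObs (A.probe t u h) w)

/-- The feedback of the first `t` rounds, in which nature draws `ω 0, …, ω (t - 1)`. -/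
noncomputable def history (A : OnlineAlgorithm M K I Seed)
    (ν : Fin M → Fin K → ProbabilityMeasure ℝ) (u : Seed) :
    (t : ℕ) → (Fin t → Outcome M K) → Fin t → Feedback M K
  | 0, _ => Fin.elim0
  | t + 1, ω =>
    let h := history A ν u t (Fin.init ω)
    let w := ω (Fin.last t)
    Fin.snoc h
      (probeObs (A.probe t u h) w, playObs ν (A.probe t u h) w (A.action t u h w))

/-- The total reward of the algorithm in round `t`. -/
noncomputable def reward (A : OnlineAlgorithm M K I Seed) (Dmax : ℕ) (α : ℕ → ℝ)
    (p : Fin M → PMF ℕ) (ν : Fin M → Fin K → ProbabilityMeasure ℝ) {T : ℕ} (u : Seed)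
    (ω : Fin T → Outcome M K) (t : Fin T) : ℝ :=
  let h := A.history ν u t (fun i => ω (Fin.castLE t.isLt.le i))
  totalReward Dmax α p ν (A.probe t u h) (ω t) (A.action t u h (ω t))

/-- The regret over `T` rounds: the cumulative reward `T · R(S⋆)` of the optimal probing policy minus
that of the algorithm. -/
noncomputable def regret (A : OnlineAlgorithm M K I Seed) (Dmax : ℕ) (α : ℕ → ℝ)
    (p : Fin M → PMF ℕ) (ν : Fin M → Fin K → ProbabilityMeasure ℝ) (T : ℕ)
    (x : Seed × (Fin T → Outcome M K)) : ℝ :=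
  ∑ _t : Fin T, optimalValue Dmax I α p ν - ∑ t : Fin T, A.reward Dmax α p ν x.1 x.2 t

end OnlineAlgorithm

/-- The joint law of the internal randomness of the algorithm and of `T` i.i.d. rounds. -/
noncomputable def runLaw {M K : ℕ} {Seed : Type*} [MeasurableSpace Seed] (ρ : Measure Seed)
    (p : Fin M → PMF ℕ) (ν : Fin M → Fin K → ProbabilityMeasure ℝ) (T : ℕ) :
    Measure (Seed × (Fin T → Outcome M K)) :=
  ρ.prod (Measure.pi fun _ : Fin T => outcomeLaw p ν)

end PUCS

/-! Two reward models that differ only in the sign of a bias of order `1/√T` cannot be told apart in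
`T` rounds, while in every round any behaviour costs order `1/√T` under at least one of them.

In the hard instance only play `0` is worth anything, so a round amounts to choosing one arm for it.
On arm `0` the reward is 7/16 or 9/16 with mean `1/2 ± η/8` (`coin`); on every other arm it is 0,
1/2 or 1 with mean 1/2 (`ternary`).

Probing arm `0` shows its realized reward and would remove the need to know the sign. The laws are
therefore chosen to make this probe wasteful: a coin never exceeds 9/16, whereas a ternary arm may
show 1, so exchanging the coin arm for an unprobed ternary arm, at the same overhead, gains a
constant (`le_gap_of_zero_mem`). No such arm is left when all arms are probed, but then the overhead
is 1; any overhead of at least 3/4 loses to not probing at all (`le_gap_of_overhead`). If arm `0` is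
not probed, then with probability bounded below every other arm draws exactly 1/2. On that event the
choice between arm `0` and the rest loses `η/8` for one of the two signs
(`le_gap_add_gap_of_zero_notMem`). Hence the losses under the two signs always add up to a constant,
depending only on `M`, times `η` (`le_gap_add_gap`).

The decision rule of a round is a function of the seed and the other rounds, and the same function
for both signs, because feedback depends on the laws only through the order of the means
(`history_congr`). Even if all `T - 1` other outcomes are revealed in full, `two_point_bound` shows
that the two models overlap by at least `(1 - 4η²)^(T-1) / 2`. With `η = 1/(4√T)` this stays bounded
below; summing over rounds gives order `√T` for the two regrets together, so one of them is that
large. -/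

namespace PUCS

/-! ### Product measures, densities and the two-point bound -/

section Measure

open ProbabilityTheory

/-- Substituting a finite-valued map with measurable fibres into a family of measurable maps. -/
theorem measurable_comp_of_measurable_fibers {X β γ : Type*} [MeasurableSpace X]
    [MeasurableSpace γ] [Finite β] {f : X → β} (hf : ∀ b, MeasurableSet {x | f x = b})
    {g : β → X → γ} (hg : ∀ b, Measurable (g b)) : Measurable fun x => g (f x) x := by
  intro s hs
  have : (fun x => g (f x) x) ⁻¹' s = ⋃ b, {x | f x = b} ∩ g b ⁻¹' s := by
    ext x
    simp
  rw [this]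
  exact MeasurableSet.iUnion fun b => (hf b).inter (hg b hs)

theorem measurableSet_comp_fiber {X β γ : Type*} [MeasurableSpace X]
    [Finite β] {f : X → β} (hf : ∀ b, MeasurableSet {x | f x = b})
    {g : β → X → γ} {c : γ} (hg : ∀ b, MeasurableSet {x | g b x = c}) :
    MeasurableSet {x | g (f x) x = c} := by
  have : {x | g (f x) x = c} = ⋃ b, {x | f x = b} ∩ {x | g b x = c} := by
    ext x
    simp
  rw [this]
  exact MeasurableSet.iUnion fun b => (hf b).inter (hg b)

theorem lintegral_pi_prod {ι : Type*} [Fintype ι] {X : ι → Type*} [∀ i, MeasurableSpace (X i)]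
    (μ : ∀ i, Measure (X i)) [∀ i, IsProbabilityMeasure (μ i)] {f : ∀ i, X i → ENNReal}
    (hf : ∀ i, Measurable (f i)) :
    ∫⁻ x, ∏ i, f i (x i) ∂Measure.pi μ = ∏ i, ∫⁻ x, f i x ∂μ i := by
  have h := lintegral_prod_eq_prod_lintegral_of_indepFun (μ := Measure.pi μ) Finset.univ
    (fun i x => f i (x i)) (iIndepFun_pi fun i => (hf i).aemeasurable)
    (fun i => (hf i).comp (measurable_pi_apply i))
  rw [h]
  exact Finset.prod_congr rfl fun i _ => (measurePreserving_eval μ i).lintegral_comp (hf i)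

theorem pi_withDensity {ι : Type*} [Fintype ι] {X : ι → Type*} [∀ i, MeasurableSpace (X i)]
    (μ : ∀ i, Measure (X i)) [∀ i, IsProbabilityMeasure (μ i)] {f : ∀ i, X i → ENNReal}
    (hf : ∀ i, Measurable (f i)) [∀ i, SigmaFinite ((μ i).withDensity (f i))] :
    Measure.pi (fun i => (μ i).withDensity (f i))
      = (Measure.pi μ).withDensity fun x => ∏ i, f i (x i) := by
  refine Measure.pi_eq fun s hs => ?_
  rw [withDensity_apply _ (MeasurableSet.univ_pi hs), ← lintegral_indicator (MeasurableSet.univ_pi hs)]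
  have : (Set.univ.pi s).indicator (fun x : ∀ i, X i => ∏ i, f i (x i))
      = fun x => ∏ i, (s i).indicator (f i) (x i) := by
    classical
    funext x
    by_cases hx : x ∈ Set.univ.pi s
    · rw [Set.indicator_of_mem hx]
      exact Finset.prod_congr rfl fun i _ =>
        (Set.indicator_of_mem (hx i (Set.mem_univ i)) _).symm
    · rw [Set.indicator_of_notMem hx]
      obtain ⟨i, hi⟩ : ∃ i, x i ∉ s i := by simpa [Set.mem_pi] using hx
      exact (Finset.prod_eq_zero (Finset.mem_univ i) (Set.indicator_of_notMem hi _)).symm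
  rw [this, lintegral_pi_prod μ fun i => (hf i).indicator (hs i)]
  refine Finset.prod_congr rfl fun i _ => ?_
  rw [withDensity_apply _ (hs i), lintegral_indicator (hs i)]

/-- Changing the law of one coordinate of a product measure by a density. -/
theorem pi_withDensity_single {ι : Type*} [Fintype ι] {X : ι → Type*}
    [∀ i, MeasurableSpace (X i)] (μ ν : ∀ i, Measure (X i)) [∀ i, IsProbabilityMeasure (μ i)]
    [∀ i, IsProbabilityMeasure (ν i)] (i₀ : ι) {f : X i₀ → ENNReal} (hf : Measurable f)
    (h₀ : ν i₀ = (μ i₀).withDensity f) (h : ∀ i, i ≠ i₀ → ν i = μ i) :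
    Measure.pi ν = (Measure.pi μ).withDensity fun x => f (x i₀) := by
  classical
  let g : ∀ i, X i → ENNReal := Function.update (fun _ _ => 1) i₀ f
  have hg₀ : g i₀ = f := Function.update_self _ _ _
  have hg : ∀ i, i ≠ i₀ → g i = fun _ => 1 := fun i hi => Function.update_of_ne hi _ _
  have hν : ν = fun i => (μ i).withDensity (g i) := by
    funext i
    by_cases hi : i = i₀
    · subst hi
      rw [hg₀, h₀]
    · rw [hg i hi, h i hi]
      exact withDensity_one.symm
  have hgm : ∀ i, Measurable (g i) := by
    intro i
    by_cases hi : i = i₀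
    · subst hi
      rwa [hg₀]
    · rw [hg i hi]
      exact measurable_const
  have hprod : (fun x : ∀ i, X i => ∏ i, g i (x i)) = fun x => f (x i₀) := by
    funext x
    rw [Finset.prod_eq_single i₀ (fun i _ hi => by rw [hg i hi]) (by simp), hg₀]
  have : ∀ i, SigmaFinite ((μ i).withDensity (g i)) := fun i => by
    rw [← congrFun hν i]
    infer_instance
  rw [← hprod, ← pi_withDensity μ hgm, ← hν]

/-- Two-point lower bound: if `Q⁺` and `Q⁻` have the densities `1 ± a y`, `y = ±1`, with respect to
`Q`, and `F⁺ + F⁻ ≥ δ` for two non-negative functions of `n` independent observations, then the sum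
of their expectations under `Q⁺` and `Q⁻` is at least `δ (1 - a²)ⁿ / 2`. -/
theorem two_point_bound {Ω Seed : Type*} [MeasurableSpace Ω] [MeasurableSpace Seed]
    (ρ : Measure Seed) [IsProbabilityMeasure ρ] (Q Qp Qm : Measure Ω) [IsProbabilityMeasure Q]
    [IsProbabilityMeasure Qp] [IsProbabilityMeasure Qm] {y : Ω → ℝ} (hy : Measurable y)
    (hy1 : ∀ᵐ w ∂Q, y w ^ 2 = 1) {a : ℝ} (ha0 : 0 ≤ a) (ha1 : a ≤ 1)
    (hp : Qp = Q.withDensity fun w => ENNReal.ofReal (1 + a * y w))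
    (hm : Qm = Q.withDensity fun w => ENNReal.ofReal (1 - a * y w))
    (n : ℕ) {Fp Fm : Seed × (Fin n → Ω) → ℝ} {δ : ℝ} (hδ : 0 ≤ δ)
    (hFp : Integrable Fp (ρ.prod (Measure.pi fun _ => Qp)))
    (hFm : Integrable Fm (ρ.prod (Measure.pi fun _ => Qm)))
    (hFp0 : ∀ x, 0 ≤ Fp x) (hFm0 : ∀ x, 0 ≤ Fm x) (hF : ∀ x, δ ≤ Fp x + Fm x) :
    δ * (1 - a ^ 2) ^ n / 2 ≤ ∫ x, Fp x ∂(ρ.prod (Measure.pi fun _ => Qp))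
      + ∫ x, Fm x ∂(ρ.prod (Measure.pi fun _ => Qm)) := by
  set P := ρ.prod (Measure.pi fun _ : Fin n => Q) with hP
  have key : ∀ (b : ℝ) (Q' : Measure Ω) [IsProbabilityMeasure Q'],
      Q' = Q.withDensity (fun w => ENNReal.ofReal (1 + b * y w)) →
      ρ.prod (Measure.pi fun _ : Fin n => Q') = P.withDensity
        (fun x => ∏ i, ENNReal.ofReal (1 + b * y (x.2 i))) := by
    intro b Q' _ h
    have hmeas : Measurable fun w => ENNReal.ofReal (1 + b * y w) := by fun_prop
    have : ∀ i : Fin n, SigmaFinite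
        (Q.withDensity fun w => ENNReal.ofReal (1 + b * y w)) := fun i => by
      rw [← h]; infer_instance
    have h2 := pi_withDensity (fun _ : Fin n => Q) (fun _ => hmeas)
    have : SFinite ((Measure.pi fun _ : Fin n => Q).withDensity
      fun x => ∏ i, ENNReal.ofReal (1 + b * y (x i))) := by
      rw [← h2]; infer_instance
    rw [h, h2, hP]
    exact prod_withDensity_right (g := fun x : Fin n → Ω => ∏ i, ENNReal.ofReal (1 + b * y (x i)))
      (by fun_prop)
  have hm' : Qm = Q.withDensity fun w => ENNReal.ofReal (1 + (-a) * y w) := by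
    rw [hm]; congr 1; funext w; congr 1; ring
  set L : ℝ → Seed × (Fin n → Ω) → ENNReal :=
    fun b x => ∏ i, ENNReal.ofReal (1 + b * y (x.2 i)) with hL
  have hLm : ∀ b, Measurable (L b) := fun b => by rw [hL]; fun_prop
  have hLt : ∀ b x, L b x < ⊤ := fun b x => ENNReal.prod_lt_top fun i _ => ENNReal.ofReal_lt_top
  have hae : ∀ᵐ x ∂P, ∀ i, y (x.2 i) ^ 2 = 1 := by
    rw [ae_all_iff]
    intro i
    have h1 : Measure.QuasiMeasurePreserving (fun x : Seed × (Fin n → Ω) => x.2 i) P Q :=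
      (Measure.quasiMeasurePreserving_eval (fun _ : Fin n => Q) i).comp
        Measure.quasiMeasurePreserving_snd
    exact h1.ae hy1
  have ep := key a Qp hp
  have em := key (-a) Qm hm'
  have ip : ∫ x, Fp x ∂(ρ.prod (Measure.pi fun _ => Qp)) = ∫ x, (L a x).toReal • Fp x ∂P := by
    rw [ep, integral_withDensity_eq_integral_toReal_smul (hLm a) (ae_of_all _ (hLt a))]
  have im : ∫ x, Fm x ∂(ρ.prod (Measure.pi fun _ => Qm)) = ∫ x, (L (-a) x).toReal • Fm x ∂P := by
    rw [em, integral_withDensity_eq_integral_toReal_smul (hLm _) (ae_of_all _ (hLt _))]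
  have jp : Integrable (fun x => (L a x).toReal • Fp x) P := by
    rw [ep] at hFp
    exact (integrable_withDensity_iff_integrable_smul' (hLm a) (ae_of_all _ (hLt a))).1 hFp
  have jm : Integrable (fun x => (L (-a) x).toReal • Fm x) P := by
    rw [em] at hFm
    exact (integrable_withDensity_iff_integrable_smul' (hLm _) (ae_of_all _ (hLt _))).1 hFm
  have hone : ∀ (b : ℝ) (Q' : Measure Ω) [IsProbabilityMeasure Q'],
      ρ.prod (Measure.pi fun _ : Fin n => Q') = P.withDensity (L b) →
      Integrable (fun x => (L b x).toReal) P ∧ ∫ x, (L b x).toReal ∂P = 1 := by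
    intro b Q' _ h
    have h1 : Integrable (fun _ => (1 : ℝ)) (ρ.prod (Measure.pi fun _ : Fin n => Q')) :=
      integrable_const _
    have h2 : ∫ _, (1 : ℝ) ∂(ρ.prod (Measure.pi fun _ : Fin n => Q')) = 1 := by simp
    rw [h] at h1 h2
    rw [integral_withDensity_eq_integral_toReal_smul (hLm b) (ae_of_all _ (hLt b))] at h2
    have h3 := (integrable_withDensity_iff_integrable_smul' (hLm b) (ae_of_all _ (hLt b))).1 h1
    simp only [smul_eq_mul, mul_one] at h2 h3
    exact ⟨h3, h2⟩
  have lp := hone a Qp ep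
  have lm := hone (-a) Qm em
  -- Since `y² = 1`, each pair of factors is `(1 + a y)(1 - a y) = 1 - a²`: the product of the two
  -- likelihood ratios is deterministic.
  have hprod : ∀ᵐ x ∂P, (L a x).toReal * (L (-a) x).toReal = (1 - a ^ 2) ^ n := by
    filter_upwards [hae] with x hx
    rw [hL]
    simp only [ENNReal.toReal_prod]
    rw [← Finset.prod_mul_distrib]
    have : ∀ i ∈ (Finset.univ : Finset (Fin n)), (ENNReal.ofReal (1 + a * y (x.2 i))).toReal
        * (ENNReal.ofReal (1 + -a * y (x.2 i))).toReal = 1 - a ^ 2 := by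
      intro i _
      have h1 : |y (x.2 i)| ≤ 1 := by
        rw [← sq_le_one_iff_abs_le_one, hx i]
      obtain ⟨h2, h3⟩ := abs_le.1 h1
      rw [ENNReal.toReal_ofReal (by nlinarith), ENNReal.toReal_ofReal (by nlinarith)]
      linear_combination -(a ^ 2) * hx i
    rw [Finset.prod_congr rfl this]
    simp
  set b := (1 - a ^ 2) ^ n
  rw [ip, im, ← integral_add jp jm]
  -- A minorant of the integrand that is affine in the likelihood ratios. Each ratio has integral 1,
  -- so the bracket integrates to 1/2.
  have hint : ∫ x, δ * b * (1 - ((L a x).toReal + (L (-a) x).toReal) / 4) ∂P = δ * b / 2 := by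
    have hsum : Integrable (fun x => (L a x).toReal + (L (-a) x).toReal) P := lp.1.add lm.1
    rw [integral_const_mul, integral_sub (integrable_const _) (hsum.div_const 4),
      integral_div, integral_add lp.1 lm.1, lp.2, lm.2]
    simp
    ring
  rw [← hint]
  refine integral_mono_ae
    (((integrable_const (1 : ℝ)).sub ((lp.1.add lm.1).div_const 4)).const_mul _) (jp.add jm) ?_
  filter_upwards [hprod] with x hx
  have hA : 0 ≤ (L a x).toReal := ENNReal.toReal_nonneg
  have hB : 0 ≤ (L (-a) x).toReal := ENNReal.toReal_nonneg
  revert hx hA hB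
  generalize (L a x).toReal = A
  generalize (L (-a) x).toReal = B
  intro hx hA hB
  simp only [smul_eq_mul]
  have h0 := hFp0 x
  have h1 := hFm0 x
  have h2 := hF x
  -- Follows from `v (1 - v/4) ≤ 1`, that is `(v/2 - 1)² ≥ 0`. By symmetry the left side is at most
  -- `min u v`; this replaces a total variation or Hellinger estimate.
  have hmin : ∀ u v : ℝ, 0 ≤ u → 0 ≤ v → u * v * (1 - (u + v) / 4) ≤ u := by
    intro u v hu hv
    nlinarith [mul_nonneg hu (sq_nonneg (v / 2 - 1)), mul_nonneg (mul_nonneg hu hu) hv]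
  have hA' := hmin A B hA hB
  have hB' := hmin B A hB hA
  rw [hx] at hA'
  rw [mul_comm B A, add_comm B A, hx] at hB'
  set z := b * (1 - (A + B) / 4) with hz
  have hz' : δ * b * (1 - (A + B) / 4) = δ * z := by rw [hz]; ring
  rw [hz']
  -- Both ratios are at least `z`. For `z ≥ 0` the bound `δ ≤ F⁺ + F⁻` is multiplied by `z`; for `z
  -- < 0` the minorant is nonpositive and the integrand is not.
  by_cases hz0 : 0 ≤ z
  · nlinarith [mul_nonneg (sub_nonneg.2 hA') h0, mul_nonneg (sub_nonneg.2 hB') h1,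
      mul_nonneg hz0 (sub_nonneg.2 h2)]
  · nlinarith [mul_nonneg hA h0, mul_nonneg hB h1]

end Measure

/-! ### Measurability of observations, histories and rewards -/

section Measurability

variable {M K : ℕ}

/-- Writing the rank of `k` as a sum of indicators makes its measurability in the keys immediate. -/
theorem mem_served {key : Fin K → ℝ} {C : Finset (Fin K)} {n : ℕ} {k : Fin K} :
    k ∈ served key C n ↔
      k ∈ C ∧ ∑ j ∈ C, (if key k < key j ∨ (key j = key k ∧ j < k) then 1 else 0) < n := by
  classical
  unfold served
  rw [Finset.mem_filter, Finset.card_filter]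

/-- Which plays are served depends only on the order of the keys. -/
theorem served_congr {x y : Fin K → ℝ} (h : ∀ i j, x i < x j ↔ y i < y j) (C : Finset (Fin K))
    (n : ℕ) : served x C n = served y C n := by
  have h' : ∀ i j, x i = x j ↔ y i = y j := fun i j => by
    rw [le_antisymm_iff, le_antisymm_iff, ← not_lt, ← not_lt, h, h, not_lt, not_lt]
  ext k
  simp only [mem_served, h, h']

theorem measurableSet_mem_served {X : Type*} [MeasurableSpace X] {f : X → Fin K → ℝ} {n : X → ℕ}
    (hf : Measurable f) (hn : Measurable n) (C : Finset (Fin K)) (k : Fin K) :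
    MeasurableSet {x | k ∈ served (f x) C (n x)} := by
  simp only [mem_served]
  have hk : ∀ j, Measurable fun x => f x j := fun j => (measurable_pi_apply j).comp hf
  refine (MeasurableSet.const _).inter (measurableSet_lt ?_ hn)
  refine Finset.measurable_sum _ fun j _ => Measurable.ite ?_ measurable_const measurable_const
  exact (measurableSet_lt (hk k) (hk j)).union
    ((measurableSet_eq_fun (hk j) (hk k)).inter (MeasurableSet.const _))

theorem measurable_topSum {X : Type*} [MeasurableSpace X] {f : X → Fin K → ℝ} {n : X → ℕ}
    (hf : Measurable f) (hn : Measurable n) (C : Finset (Fin K)) :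
    Measurable fun x => topSum (f x) C (n x) := by
  classical
  have : (fun x => topSum (f x) C (n x))
      = fun x => ∑ k, if k ∈ served (f x) C (n x) then f x k else 0 := by
    funext x
    unfold topSum
    rw [← Finset.sum_filter]
    congr 1
    ext k
    simp
  rw [this]
  exact Finset.measurable_sum _ fun k _ => Measurable.ite (measurableSet_mem_served hf hn C k)
    ((measurable_pi_apply k).comp hf) measurable_const

theorem measurable_grossReward (Dmax : ℕ) (p : Fin M → PMF ℕ)
    (ν : Fin M → Fin K → ProbabilityMeasure ℝ) (S : Finset (Fin M)) (C : Assignment M K) :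
    Measurable fun w => grossReward Dmax p ν S w C := by
  unfold grossReward
  refine (Finset.measurable_sum _ fun m _ => ?_).add measurable_const
  exact measurable_topSum (by fun_prop) (by fun_prop) _

theorem measurable_totalReward (Dmax : ℕ) (α : ℕ → ℝ) (p : Fin M → PMF ℕ)
    (ν : Fin M → Fin K → ProbabilityMeasure ℝ) (S : Finset (Fin M)) (C : Assignment M K) :
    Measurable fun w => totalReward Dmax α p ν S w C :=
  (measurable_grossReward Dmax p ν S C).const_mul _

theorem measurable_hTotal (Dmax : ℕ) (p : Fin M → PMF ℕ)
    (ν : Fin M → Fin K → ProbabilityMeasure ℝ) (S : Finset (Fin M)) :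
    Measurable (hTotal Dmax p ν S) := by
  have h := Finset.measurable_sup' (Finset.univ_nonempty (α := Assignment M K))
    (f := fun C w => grossReward Dmax p ν S w C)
    (fun C _ => measurable_grossReward Dmax p ν S C)
  convert h using 1
  funext w
  rw [Finset.sup'_apply]
  rfl

theorem measurable_probeObs (S : Finset (Fin M)) :
    Measurable (probeObs S : Outcome M K → ProbeObs M K) := by
  refine measurable_pi_lambda _ fun m => ?_
  unfold probeObs
  split_ifs
  · exact measurable_inr.comp (by fun_prop)
  · exact measurable_const

theorem measurable_playObs (ν : Fin M → Fin K → ProbabilityMeasure ℝ) (S : Finset (Fin M))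
    (C : Assignment M K) : Measurable fun w => playObs ν S w C := by
  unfold playObs
  refine Measurable.prodMk (measurable_pi_lambda _ fun m => ?_)
    (measurable_pi_lambda _ fun m => measurable_pi_lambda _ fun k => ?_)
  · split_ifs
    · exact measurable_inr.comp (by fun_prop)
    · exact measurable_const
  · refine Measurable.ite ?_ (measurable_inr.comp (by fun_prop)) measurable_const
    refine measurableSet_mem_served ?_ (by fun_prop) _ _
    split_ifs
    · fun_prop
    · exact measurable_const

namespace OnlineAlgorithm

variable {I : ℕ} {Seed : Type*} [MeasurableSpace Seed] {X : Type*} [MeasurableSpace X]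

theorem measurableSet_probe (A : OnlineAlgorithm M K I Seed) (t : ℕ) {u : X → Seed}
    {h : X → Fin t → Feedback M K} (hu : Measurable u) (hh : Measurable h) (S : Finset (Fin M)) :
    MeasurableSet {x | A.probe t (u x) (h x) = S} :=
  (hu.prodMk hh) (A.measurable_probe t S)

theorem measurableSet_action (A : OnlineAlgorithm M K I Seed) (t : ℕ) {u : X → Seed}
    {h : X → Fin t → Feedback M K} {w : X → Outcome M K} (hu : Measurable u) (hh : Measurable h)
    (hw : Measurable w) (C : Assignment M K) :
    MeasurableSet {x | A.action t (u x) (h x) (w x) = C} :=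
  measurableSet_comp_fiber (g := fun S x => A.assign t (u x) (h x) (probeObs S (w x)))
    (A.measurableSet_probe t hu hh)
    fun S => (hu.prodMk (hh.prodMk ((measurable_probeObs S).comp hw))) (A.measurable_assign t C)

theorem measurable_comp_probe_action {γ : Type*} [MeasurableSpace γ]
    (A : OnlineAlgorithm M K I Seed) (t : ℕ) {u : X → Seed}
    {h : X → Fin t → Feedback M K} {w : X → Outcome M K} (hu : Measurable u) (hh : Measurable h)
    (hw : Measurable w) {g : Finset (Fin M) → Assignment M K → Outcome M K → γ}
    (hg : ∀ S C, Measurable (g S C)) :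
    Measurable fun x => g (A.probe t (u x) (h x)) (A.action t (u x) (h x) (w x)) (w x) :=
  measurable_comp_of_measurable_fibers (A.measurableSet_probe t hu hh)
    (g := fun S x => g S (A.action t (u x) (h x) (w x)) (w x))
    fun S => measurable_comp_of_measurable_fibers (A.measurableSet_action t hu hh hw)
      (g := fun C x => g S C (w x)) fun C => (hg S C).comp hw

theorem measurable_history (A : OnlineAlgorithm M K I Seed)
    (ν : Fin M → Fin K → ProbabilityMeasure ℝ) (t : ℕ) :
    Measurable fun x : Seed × (Fin t → Outcome M K) => A.history ν x.1 t x.2 := by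
  induction t with
  | zero => exact measurable_pi_lambda _ fun i => i.elim0
  | succ t ih =>
    have hinit : Measurable fun x : Seed × (Fin (t + 1) → Outcome M K) =>
        (x.1, (Fin.init x.2 : Fin t → Outcome M K)) :=
      measurable_fst.prodMk (measurable_pi_lambda _ fun i =>
        (measurable_pi_apply (Fin.castSucc i)).comp measurable_snd)
    have hh := ih.comp hinit
    have hw : Measurable fun x : Seed × (Fin (t + 1) → Outcome M K) => x.2 (Fin.last t) :=
      (measurable_pi_apply _).comp measurable_snd
    refine measurable_pi_lambda _ fun i => ?_
    simp only [history]
    refine Fin.lastCases ?_ (fun i => ?_) i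
    · simp only [Fin.snoc_last]
      exact A.measurable_comp_probe_action t measurable_fst hh hw
        (g := fun S C w => (probeObs S w, playObs ν S w C))
        fun S C => (measurable_probeObs S).prodMk (measurable_playObs ν S C)
    · simp only [Fin.snoc_castSucc]
      exact (measurable_pi_apply i).comp hh

theorem measurable_reward (A : OnlineAlgorithm M K I Seed) (Dmax : ℕ) (α : ℕ → ℝ)
    (p : Fin M → PMF ℕ) (ν : Fin M → Fin K → ProbabilityMeasure ℝ) {T : ℕ} (t : Fin T) :
    Measurable fun x : Seed × (Fin T → Outcome M K) => A.reward Dmax α p ν x.1 x.2 t := by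
  have hh : Measurable fun x : Seed × (Fin T → Outcome M K) =>
      A.history ν x.1 t (fun i => x.2 (Fin.castLE t.isLt.le i)) := by
    have hr : Measurable fun x : Seed × (Fin T → Outcome M K) =>
        (x.1, fun i : Fin t => x.2 (Fin.castLE t.isLt.le i)) := by fun_prop
    exact (A.measurable_history ν t).comp hr
  exact A.measurable_comp_probe_action t measurable_fst hh
    ((measurable_pi_apply t).comp measurable_snd)
    (g := fun S C w => totalReward Dmax α p ν S w C) fun S C => measurable_totalReward Dmax α p ν S C

/-- The feedback depends on the reward laws only through the order of the means on each arm. -/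
theorem history_congr (A : OnlineAlgorithm M K I Seed)
    {ν ν' : Fin M → Fin K → ProbabilityMeasure ℝ}
    (h : ∀ m i j, mean ν m i < mean ν m j ↔ mean ν' m i < mean ν' m j) (u : Seed) (t : ℕ)
    (ω : Fin t → Outcome M K) : A.history ν u t ω = A.history ν' u t ω := by
  -- The means enter the feedback only as priority keys on unprobed arms.
  have hplay : ∀ S w C, playObs (M := M) (K := K) ν S w C = playObs ν' S w C := by
    intro S w C
    unfold playObs
    congr 1
    funext m k
    have : served (if m ∈ S then w.2 m else mean ν m) (plays C m) (w.1 m)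
        = served (if m ∈ S then w.2 m else mean ν' m) (plays C m) (w.1 m) := by
      split_ifs
      · rfl
      · exact served_congr (h m) _ _
    rw [this]
  induction t with
  | zero => rfl
  | succ t ih => simp only [history, ih, hplay]

end OnlineAlgorithm

end Measurability

/-! ### Rewards when only one play has value -/

section SinglePlay

variable {N L : ℕ}

/-- Play `0` has a largest key and wins ties as the smallest index, so a single unit of resource
already serves it. This is why the resource laws do not matter in the hard instance. -/
theorem topSum_eq_of_single {x : Fin (L + 1) → ℝ} (h0 : 0 ≤ x 0) (h : ∀ k, k ≠ 0 → x k = 0)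
    (C : Finset (Fin (L + 1))) {n : ℕ} (hn : 1 ≤ n) :
    topSum x C n = if 0 ∈ C then x 0 else 0 := by
  unfold topSum
  have hmem : (0 : Fin (L + 1)) ∈ served x C n ↔ 0 ∈ C := by
    rw [mem_served, Finset.sum_eq_zero]
    · exact ⟨fun h => h.1, fun h => ⟨h, by omega⟩⟩
    · intro j _
      rw [if_neg]
      rintro (h1 | ⟨_, h2⟩)
      · by_cases hj : j = 0
        · subst hj
          exact lt_irrefl _ h1
        · rw [h j hj] at h1
          exact absurd h1 (not_lt.2 h0)
      · exact absurd h2 (Fin.not_lt_zero j)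
  split_ifs with hC
  · exact Finset.sum_eq_single_of_mem 0 (hmem.2 hC) fun k _ hk => h k hk
  · refine Finset.sum_eq_zero fun k hk => h k ?_
    rintro rfl
    exact hC (hmem.1 hk)

theorem sum_Icc_toReal_eq_one {Dmax : ℕ} {q : PMF ℕ} (hq : ∀ d, q d ≠ 0 → 1 ≤ d ∧ d ≤ Dmax) :
    ∑ d ∈ Finset.Icc 1 Dmax, (q d).toReal = 1 := by
  rw [← ENNReal.toReal_sum fun d _ => q.apply_ne_top d, ← ENNReal.toReal_one, ← q.tsum_coe]
  congr 1
  refine (tsum_eq_sum fun d hd => ?_).symm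
  by_contra h
  exact hd (Finset.mem_Icc.2 (hq d h))

theorem unprobedReward_eq_of_single {Dmax : ℕ} {q : PMF ℕ}
    (hq : ∀ d, q d ≠ 0 → 1 ≤ d ∧ d ≤ Dmax) {x : Fin (L + 1) → ℝ} (h0 : 0 ≤ x 0)
    (h : ∀ k, k ≠ 0 → x k = 0) (C : Finset (Fin (L + 1))) :
    unprobedReward Dmax q x C = if 0 ∈ C then x 0 else 0 := by
  unfold unprobedReward
  rw [Finset.sum_congr rfl fun d hd => by
    rw [topSum_eq_of_single h0 h C (Finset.mem_Icc.1 hd).1], ← Finset.sum_mul,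
    sum_Icc_toReal_eq_one hq, one_mul]

end SinglePlay

/-! ### The hard instance: one biased coin arm among ternary arms -/

section HardInstance

/-- A two-point law with values `7/16` and `9/16` and mean `1/2 + e/8`. -/
noncomputable def coin (e : ℝ) : Measure ℝ :=
  ENNReal.ofReal (1 / 2 + e) • Measure.dirac (9 / 16)
    + ENNReal.ofReal (1 / 2 - e) • Measure.dirac (7 / 16)

/-- The law with values `0`, `1/2`, `1` taken with probabilities `1/4`, `1/2`, `1/4`. -/
noncomputable def ternary : Measure ℝ :=
  ENNReal.ofReal (1 / 4) • Measure.dirac 0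
    + ENNReal.ofReal (1 / 2) • Measure.dirac (1 / 2) + ENNReal.ofReal (1 / 4) • Measure.dirac 1

theorem isProbabilityMeasure_coin {e : ℝ} (he : |e| ≤ 1 / 4) : IsProbabilityMeasure (coin e) := by
  obtain ⟨h1, h2⟩ := abs_le.1 he
  constructor
  simp only [coin, Measure.add_apply, Measure.smul_apply, measure_univ, smul_eq_mul, mul_one]
  rw [← ENNReal.ofReal_add (by linarith) (by linarith), ← ENNReal.ofReal_one]
  congr 1
  ring

instance isProbabilityMeasure_ternary : IsProbabilityMeasure ternary := by
  constructor
  simp only [ternary, Measure.add_apply, Measure.smul_apply, measure_univ, smul_eq_mul, mul_one]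
  rw [← ENNReal.ofReal_add (by norm_num) (by norm_num),
    ← ENNReal.ofReal_add (by norm_num) (by norm_num), ← ENNReal.ofReal_one]
  congr 1
  norm_num

theorem integral_coin {e : ℝ} (he : |e| ≤ 1 / 4) : ∫ x, x ∂coin e = 1 / 2 + e / 8 := by
  obtain ⟨h1, h2⟩ := abs_le.1 he
  have i : ∀ a b : ℝ, Integrable (fun x : ℝ => x) (ENNReal.ofReal a • Measure.dirac b) :=
    fun a b => (integrable_dirac (by simp)).smul_measure ENNReal.ofReal_ne_top
  rw [coin, integral_add_measure (i _ _) (i _ _), integral_smul_measure, integral_smul_measure,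
    integral_dirac, integral_dirac, ENNReal.toReal_ofReal (by linarith),
    ENNReal.toReal_ofReal (by linarith)]
  simp only [smul_eq_mul]
  ring

theorem integral_ternary : ∫ x, x ∂ternary = 1 / 2 := by
  have i : ∀ a b : ℝ, Integrable (fun x : ℝ => x) (ENNReal.ofReal a • Measure.dirac b) :=
    fun a b => (integrable_dirac (by simp)).smul_measure ENNReal.ofReal_ne_top
  rw [ternary, integral_add_measure ((i _ _).add_measure (i _ _)) (i _ _),
    integral_add_measure (i _ _) (i _ _), integral_smul_measure, integral_smul_measure,
    integral_smul_measure, integral_dirac, integral_dirac, integral_dirac,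
    ENNReal.toReal_ofReal (by norm_num), ENNReal.toReal_ofReal (by norm_num)]
  norm_num

theorem ae_coin (e : ℝ) : ∀ᵐ x ∂coin e, x = 9 / 16 ∨ x = 7 / 16 := by
  rw [ae_iff]
  change coin e {x : ℝ | x = 9 / 16 ∨ x = 7 / 16}ᶜ = 0
  simp [coin]

theorem ae_ternary : ∀ᵐ x ∂ternary, x = 0 ∨ x = 1 / 2 ∨ x = 1 := by
  rw [ae_iff]
  change ternary {x : ℝ | x = 0 ∨ x = 1 / 2 ∨ x = 1}ᶜ = 0
  simp [ternary]

theorem ternary_real_half : ternary.real {1 / 2} = 1 / 2 := by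
  rw [Measure.real]
  simp only [ternary, Measure.add_apply, Measure.smul_apply, Measure.dirac_apply, smul_eq_mul]
  norm_num

theorem ternary_real_ne_one : ternary.real {1}ᶜ = 3 / 4 := by
  rw [Measure.real]
  simp only [ternary, Measure.add_apply, Measure.smul_apply, Measure.dirac_apply, smul_eq_mul]
  norm_num [Set.indicator]
  rw [← ENNReal.ofReal_add (by norm_num) (by norm_num), ENNReal.toReal_ofReal (by norm_num)]
  norm_num

/-- The factor `16 (x - 1/2)` is `+1` at 9/16 and `-1` at 7/16, which gives the form `1 ± a y` of
`two_point_bound` with `a = 2|e|`. -/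
theorem coin_eq_withDensity {e : ℝ} (he : |e| ≤ 1 / 4) :
    coin e = (coin 0).withDensity
      fun x => ENNReal.ofReal (1 + 2 * e * (16 * (x - 1 / 2))) := by
  obtain ⟨h1, h2⟩ := abs_le.1 he
  have hm : Measurable fun x : ℝ => ENNReal.ofReal (1 + 2 * e * (16 * (x - 1 / 2))) := by fun_prop
  unfold coin
  rw [withDensity_add_measure, withDensity_smul_measure, withDensity_smul_measure,
    dirac_withDensity, dirac_withDensity, smul_smul, smul_smul,
    ← ENNReal.ofReal_mul (by norm_num), ← ENNReal.ofReal_mul (by norm_num)]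
  congr 3 <;> ring_nf

/-- The reward laws of the hard instance: only the first play has a reward; on the first arm its
law is `coin e`, on the other arms `ternary`. -/
noncomputable def rewardLaw (N L : ℕ) {e : ℝ} (he : |e| ≤ 1 / 4) (m : Fin (N + 2))
    (k : Fin (L + 1)) : ProbabilityMeasure ℝ :=
  if k = 0 then
    if m = 0 then ⟨coin e, isProbabilityMeasure_coin he⟩ else ⟨ternary, inferInstance⟩
  else ⟨Measure.dirac 0, inferInstance⟩

/-- The values that occur with probability one in the hard instance. -/
structure Typical {N L : ℕ} (w : Outcome (N + 2) (L + 1)) : Prop where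
  resource : ∀ m, 1 ≤ w.1 m
  other : ∀ m k, k ≠ 0 → w.2 m k = 0
  zero : w.2 0 0 = 9 / 16 ∨ w.2 0 0 = 7 / 16
  succ : ∀ m, m ≠ 0 → w.2 m 0 = 0 ∨ w.2 m 0 = 1 / 2 ∨ w.2 m 0 = 1

variable {N L : ℕ}

theorem coe_rewardLaw_zero_zero {e : ℝ} (he : |e| ≤ 1 / 4) :
    (rewardLaw N L he 0 0 : Measure ℝ) = coin e := by simp [rewardLaw]

theorem coe_rewardLaw_succ {e : ℝ} (he : |e| ≤ 1 / 4) {m : Fin (N + 2)} (hm : m ≠ 0) :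
    (rewardLaw N L he m 0 : Measure ℝ) = ternary := by simp [rewardLaw, hm]

theorem coe_rewardLaw_other {e : ℝ} (he : |e| ≤ 1 / 4) (m : Fin (N + 2)) {k : Fin (L + 1)}
    (hk : k ≠ 0) : (rewardLaw N L he m k : Measure ℝ) = Measure.dirac 0 := by
  simp [rewardLaw, hk]

theorem mean_rewardLaw_zero_zero {e : ℝ} (he : |e| ≤ 1 / 4) :
    mean (rewardLaw N L he) 0 0 = 1 / 2 + e / 8 := by
  rw [mean, coe_rewardLaw_zero_zero, integral_coin he]

theorem mean_rewardLaw_succ {e : ℝ} (he : |e| ≤ 1 / 4) {m : Fin (N + 2)} (hm : m ≠ 0) :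
    mean (rewardLaw N L he) m 0 = 1 / 2 := by
  rw [mean, coe_rewardLaw_succ he hm, integral_ternary]

theorem mean_rewardLaw_other {e : ℝ} (he : |e| ≤ 1 / 4) (m : Fin (N + 2)) {k : Fin (L + 1)}
    (hk : k ≠ 0) : mean (rewardLaw N L he) m k = 0 := by
  rw [mean, coe_rewardLaw_other he m hk, integral_dirac]

theorem mean_rewardLaw_mem {e : ℝ} (he : |e| ≤ 1 / 4) (m : Fin (N + 2)) :
    1 / 4 ≤ mean (rewardLaw N L he) m 0 ∧ mean (rewardLaw N L he) m 0 ≤ 9 / 16 := by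
  obtain ⟨h1, h2⟩ := abs_le.1 he
  by_cases hm : m = 0
  · subst hm
    rw [mean_rewardLaw_zero_zero he]
    constructor <;> linarith
  · rw [mean_rewardLaw_succ he hm]
    norm_num

/-- The mean of play `0` stays above 1/4 and the others are 0, so the bias never changes the order.
This is the hypothesis of `history_congr`: the priorities among plays leak nothing about the sign.
-/
theorem mean_rewardLaw_lt_iff {e e' : ℝ} (he : |e| ≤ 1 / 4) (he' : |e'| ≤ 1 / 4)
    (m : Fin (N + 2)) (i j : Fin (L + 1)) :
    mean (rewardLaw N L he) m i < mean (rewardLaw N L he) m j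
      ↔ mean (rewardLaw N L he') m i < mean (rewardLaw N L he') m j := by
  have h := (mean_rewardLaw_mem (L := L) he m).1
  have h' := (mean_rewardLaw_mem (L := L) he' m).1
  by_cases hi : i = 0 <;> by_cases hj : j = 0
  · simp [hi, hj]
  · rw [mean_rewardLaw_other he m hj, mean_rewardLaw_other he' m hj, hi]
    constructor <;> intro h3 <;> linarith
  · rw [mean_rewardLaw_other he m hi, mean_rewardLaw_other he' m hi, hj]
    constructor <;> intro h3 <;> linarith
  · simp [mean_rewardLaw_other he m hi, mean_rewardLaw_other he' m hi,
      mean_rewardLaw_other he m hj, mean_rewardLaw_other he' m hj]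

theorem rewardLaw_Icc_compl {e : ℝ} (he : |e| ≤ 1 / 4) (m : Fin (N + 2)) (k : Fin (L + 1)) :
    (rewardLaw N L he m k : Measure ℝ) (Set.Icc (0 : ℝ) 1)ᶜ = 0 := by
  change ∀ᵐ x ∂(rewardLaw N L he m k : Measure ℝ), x ∈ Set.Icc (0 : ℝ) 1
  by_cases hk : k = 0
  · by_cases hm : m = 0
    · rw [hk, hm, coe_rewardLaw_zero_zero]
      filter_upwards [ae_coin e] with x hx
      rcases hx with rfl | rfl <;> norm_num
    · rw [hk, coe_rewardLaw_succ he hm]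
      filter_upwards [ae_ternary] with x hx
      rcases hx with rfl | rfl | rfl <;> norm_num
  · rw [coe_rewardLaw_other he m hk]
    simp [ae_dirac_eq]

instance isProbabilityMeasure_outcomeLaw {M K : ℕ} (p : Fin M → PMF ℕ)
    (ν : Fin M → Fin K → ProbabilityMeasure ℝ) : IsProbabilityMeasure (outcomeLaw p ν) := by
  unfold outcomeLaw
  infer_instance

theorem ae_outcomeLaw_resource {M K : ℕ} (p : Fin M → PMF ℕ)
    (ν : Fin M → Fin K → ProbabilityMeasure ℝ) (m : Fin M) {P : ℕ → Prop}
    (h : ∀ᵐ d ∂(p m).toMeasure, P d) : ∀ᵐ w ∂outcomeLaw p ν, P (w.1 m) :=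
  ((Measure.quasiMeasurePreserving_eval (fun m => (p m).toMeasure) m).comp
    Measure.quasiMeasurePreserving_fst).ae h

theorem ae_outcomeLaw_reward {M K : ℕ} (p : Fin M → PMF ℕ)
    (ν : Fin M → Fin K → ProbabilityMeasure ℝ) (m : Fin M) (k : Fin K) {P : ℝ → Prop}
    (h : ∀ᵐ x ∂(ν m k : Measure ℝ), P x) : ∀ᵐ w ∂outcomeLaw p ν, P (w.2 m k) :=
  (((Measure.quasiMeasurePreserving_eval (fun k => (ν m k : Measure ℝ)) k).comp
    (Measure.quasiMeasurePreserving_eval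
      (fun m => Measure.pi fun k => (ν m k : Measure ℝ)) m)).comp
    Measure.quasiMeasurePreserving_snd).ae h

theorem ae_typical {Dmax : ℕ} {p : Fin (N + 2) → PMF ℕ}
    (hp : ∀ m d, p m d ≠ 0 → 1 ≤ d ∧ d ≤ Dmax) {e : ℝ} (he : |e| ≤ 1 / 4) :
    ∀ᵐ w ∂outcomeLaw p (rewardLaw N L he), Typical w := by
  have h1 : ∀ᵐ w ∂outcomeLaw p (rewardLaw N L he), ∀ m, 1 ≤ w.1 m := by
    refine ae_all_iff.2 fun m => ae_outcomeLaw_resource p _ m ?_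
    rw [ae_iff, PMF.toMeasure_apply_eq_zero_iff _ (by measurability), Set.disjoint_left]
    intro d hd h
    exact h (hp m d ((PMF.mem_support_iff _ _).1 hd)).1
  have h2 : ∀ᵐ w ∂outcomeLaw p (rewardLaw N L he), ∀ m k, k ≠ 0 → w.2 m k = 0 := by
    refine ae_all_iff.2 fun m => ae_all_iff.2 fun k => ?_
    by_cases hk : k = 0
    · exact ae_of_all _ fun w h => absurd hk h
    · have := ae_outcomeLaw_reward p (rewardLaw N L he) m k (P := fun x => x = 0)
        (by rw [coe_rewardLaw_other he m hk]; simp [ae_dirac_eq])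
      filter_upwards [this] with w hw _ using hw
  have h3 := ae_outcomeLaw_reward p (rewardLaw N L he) 0 0
    (by rw [coe_rewardLaw_zero_zero]; exact ae_coin e)
  have h4 : ∀ᵐ w ∂outcomeLaw p (rewardLaw N L he),
      ∀ m, m ≠ 0 → w.2 m 0 = 0 ∨ w.2 m 0 = 1 / 2 ∨ w.2 m 0 = 1 := by
    refine ae_all_iff.2 fun m => ?_
    by_cases hm : m = 0
    · exact ae_of_all _ fun w h => absurd hm h
    · filter_upwards [ae_outcomeLaw_reward p (rewardLaw N L he) m 0
        (by rw [coe_rewardLaw_succ he hm]; exact ae_ternary)] with w hw _ using hw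
  filter_upwards [h1, h2, h3, h4] with w w1 w2 w3 w4 using ⟨w1, w2, w3, w4⟩

theorem outcomeLaw_real_forall_mem (p : Fin (N + 2) → PMF ℕ) {e : ℝ} (he : |e| ≤ 1 / 4)
    {A : Finset (Fin (N + 2))} (hA : 0 ∉ A) {B : Set ℝ} (hB : MeasurableSet B) :
    (outcomeLaw p (rewardLaw N L he)).real {w | ∀ m ∈ A, w.2 m 0 ∈ B}
      = ternary.real B ^ A.card := by
  have hset : {w : Outcome (N + 2) (L + 1) | ∀ m ∈ A, w.2 m 0 ∈ B}
      = Prod.snd ⁻¹' (Set.pi A fun _ => {x : Fin (L + 1) → ℝ | x 0 ∈ B}) := by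
    ext w
    simp [Set.mem_pi]
  have hB' : MeasurableSet {x : Fin (L + 1) → ℝ | x 0 ∈ B} := measurable_pi_apply 0 hB
  rw [hset, Measure.real, outcomeLaw, measurePreserving_snd.measure_preimage
    (MeasurableSet.pi A.countable_toSet fun _ _ => hB').nullMeasurableSet,
    Measure.pi_pi_finset, ENNReal.toReal_prod, Finset.prod_congr rfl, Finset.prod_const]
  intro m hm
  have hm0 : m ≠ 0 := fun h => hA (h ▸ hm)
  have := (measurePreserving_eval (fun k => (rewardLaw N L he m k : Measure ℝ)) 0).measure_preimage
    hB.nullMeasurableSet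
  rw [coe_rewardLaw_succ he hm0] at this
  rw [Measure.real, ← this]
  rfl

/-- Only the coordinate of arm `0`, play `0` depends on `e`, so the density of a whole round is that
of this one coin. -/
theorem outcomeLaw_eq_withDensity (p : Fin (N + 2) → PMF ℕ) {e : ℝ} (he : |e| ≤ 1 / 4)
    (h0 : |(0 : ℝ)| ≤ 1 / 4) :
    outcomeLaw p (rewardLaw N L he) = (outcomeLaw p (rewardLaw N L h0)).withDensity
      fun w => ENNReal.ofReal (1 + 2 * e * (16 * (w.2 0 0 - 1 / 2))) := by
  have hm : Measurable fun x : ℝ => ENNReal.ofReal (1 + 2 * e * (16 * (x - 1 / 2))) := by fun_prop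
  have h1 := pi_withDensity_single (fun k => (rewardLaw N L h0 0 k : Measure ℝ))
    (fun k => (rewardLaw N L he 0 k : Measure ℝ)) 0 hm
    (by rw [coe_rewardLaw_zero_zero, coe_rewardLaw_zero_zero, ← coin_eq_withDensity he])
    (fun k hk => by rw [coe_rewardLaw_other he 0 hk, coe_rewardLaw_other h0 0 hk])
  have h2 := pi_withDensity_single
    (fun m => Measure.pi fun k => (rewardLaw N L h0 m k : Measure ℝ))
    (fun m => Measure.pi fun k => (rewardLaw N L he m k : Measure ℝ)) 0
    (f := fun x => ENNReal.ofReal (1 + 2 * e * (16 * (x 0 - 1 / 2)))) (by fun_prop) h1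
    (fun m hm => by
      congr 1
      funext k
      by_cases hk : k = 0
      · rw [hk, coe_rewardLaw_succ he hm, coe_rewardLaw_succ h0 hm]
      · rw [coe_rewardLaw_other he m hk, coe_rewardLaw_other h0 m hk])
  unfold outcomeLaw
  have : SFinite ((Measure.pi fun m => Measure.pi fun k =>
      (rewardLaw N L h0 m k : Measure ℝ)).withDensity
        fun x => ENNReal.ofReal (1 + 2 * e * (16 * (x 0 0 - 1 / 2)))) := by
    rw [← h2]; infer_instance
  rw [h2]
  exact prod_withDensity_right
    (g := fun x : Fin (N + 2) → Fin (L + 1) → ℝ =>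
      ENNReal.ofReal (1 + 2 * e * (16 * (x 0 0 - 1 / 2)))) (by fun_prop)

end HardInstance

/-! ### Expected loss in a single round -/

section Gap

variable {N L Dmax I : ℕ} {p : Fin (N + 2) → PMF ℕ} {α : ℕ → ℝ}

theorem grossReward_eq (hp : ∀ m d, p m d ≠ 0 → 1 ≤ d ∧ d ≤ Dmax) {e : ℝ} (he : |e| ≤ 1 / 4)
    (S : Finset (Fin (N + 2))) {w : Outcome (N + 2) (L + 1)} (hw : Typical w)
    (C : Assignment (N + 2) (L + 1)) :
    grossReward Dmax p (rewardLaw N L he) S w C = (C 0).elim 0 fun m =>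
      if m ∈ S then w.2 m 0 else mean (rewardLaw N L he) m 0 := by
  have hX0 : ∀ m, 0 ≤ w.2 m 0 := by
    intro m
    by_cases hm : m = 0
    · subst hm
      rcases hw.zero with h | h <;> rw [h] <;> norm_num
    · rcases hw.succ m hm with h | h | h <;> rw [h]; norm_num; norm_num
  have h1 : ∀ m ∈ S, topSum (w.2 m) (plays C m) (w.1 m)
      = if C 0 = some m then w.2 m 0 else 0 := fun m _ => by
    rw [topSum_eq_of_single (hX0 m) (hw.other m) _ (hw.resource m)]
    simp [plays]
  have h2 : ∀ m ∈ Sᶜ, unprobedReward Dmax (p m) (mean (rewardLaw N L he) m) (plays C m)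
      = if C 0 = some m then mean (rewardLaw N L he) m 0 else 0 := fun m _ => by
    rw [unprobedReward_eq_of_single (hp m)
      (le_trans (by norm_num) (mean_rewardLaw_mem he m).1)
      (fun k hk => mean_rewardLaw_other he m hk)]
    simp [plays]
  unfold grossReward
  rw [Finset.sum_congr rfl h1, Finset.sum_congr rfl h2]
  cases hC : C 0 with
  | none => simp
  | some m => by_cases hm : m ∈ S <;> simp [hm]

theorem grossReward_mem_Icc (hp : ∀ m d, p m d ≠ 0 → 1 ≤ d ∧ d ≤ Dmax) {e : ℝ}
    (he : |e| ≤ 1 / 4) (S : Finset (Fin (N + 2))) {w : Outcome (N + 2) (L + 1)} (hw : Typical w)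
    (C : Assignment (N + 2) (L + 1)) :
    0 ≤ grossReward Dmax p (rewardLaw N L he) S w C
      ∧ grossReward Dmax p (rewardLaw N L he) S w C ≤ 1 := by
  rw [grossReward_eq hp he S hw]
  cases C 0 with
  | none => simp
  | some m =>
    simp only [Option.elim_some]
    split_ifs
    · by_cases hm : m = 0
      · subst hm
        rcases hw.zero with h | h <;> rw [h] <;> norm_num
      · rcases hw.succ m hm with h | h | h <;> rw [h] <;> norm_num
    · have h := mean_rewardLaw_mem (L := L) he m
      constructor <;> linarith

theorem grossReward_le_hTotal {M K : ℕ} (Dmax : ℕ) (p : Fin M → PMF ℕ)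
    (ν : Fin M → Fin K → ProbabilityMeasure ℝ) (S : Finset (Fin M)) (w : Outcome M K)
    (C : Assignment M K) : grossReward Dmax p ν S w C ≤ hTotal Dmax p ν S w :=
  Finset.le_sup' (grossReward Dmax p ν S w) (Finset.mem_univ C)

theorem probingValue_le_optimalValue {M K : ℕ} (Dmax : ℕ) (α : ℕ → ℝ) (p : Fin M → PMF ℕ)
    (ν : Fin M → Fin K → ProbabilityMeasure ℝ) {S : Finset (Fin M)} (hS : S.card ≤ I) :
    probingValue Dmax α p ν S ≤ optimalValue Dmax I α p ν :=
  Finset.le_sup' (probingValue Dmax α p ν)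
    (Finset.mem_filter.2 ⟨Finset.mem_univ S, hS⟩)

theorem integrable_hTotal (hp : ∀ m d, p m d ≠ 0 → 1 ≤ d ∧ d ≤ Dmax) {e : ℝ}
    (he : |e| ≤ 1 / 4) (S : Finset (Fin (N + 2))) :
    Integrable (hTotal Dmax p (rewardLaw N L he) S) (outcomeLaw p (rewardLaw N L he)) := by
  refine Integrable.of_bound (measurable_hTotal Dmax p _ S).aestronglyMeasurable 1 ?_
  filter_upwards [ae_typical hp he] with w hw
  rw [Real.norm_eq_abs, abs_le]
  constructor
  · have h1 := grossReward_le_hTotal Dmax p (rewardLaw N L he) S w fun _ => none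
    have h2 := (grossReward_mem_Icc hp he S hw fun _ => none).1
    linarith
  · exact Finset.sup'_le _ _ fun C _ => (grossReward_mem_Icc hp he S hw C).2

theorem integrable_grossReward (hp : ∀ m d, p m d ≠ 0 → 1 ≤ d ∧ d ≤ Dmax) {e : ℝ}
    (he : |e| ≤ 1 / 4) (S : Finset (Fin (N + 2)))
    {c : Outcome (N + 2) (L + 1) → Assignment (N + 2) (L + 1)}
    (hc : ∀ C, MeasurableSet {w | c w = C}) :
    Integrable (fun w => grossReward Dmax p (rewardLaw N L he) S w (c w))
      (outcomeLaw p (rewardLaw N L he)) := by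
  refine Integrable.of_bound (measurable_comp_of_measurable_fibers hc
    (g := fun C w => grossReward Dmax p (rewardLaw N L he) S w C)
    (measurable_grossReward Dmax p _ S)).aestronglyMeasurable 1 ?_
  filter_upwards [ae_typical hp he] with w hw
  have h := grossReward_mem_Icc hp he S hw (c w)
  rw [Real.norm_eq_abs, abs_le]
  constructor <;> linarith

/-- The expected loss, against the optimal value, of probing `S` and then assigning by `c`. -/
noncomputable def gap (Dmax I : ℕ) (α : ℕ → ℝ) (p : Fin (N + 2) → PMF ℕ) {e : ℝ}
    (he : |e| ≤ 1 / 4) (S : Finset (Fin (N + 2)))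
    (c : Outcome (N + 2) (L + 1) → Assignment (N + 2) (L + 1)) : ℝ :=
  optimalValue Dmax I α p (rewardLaw N L he)
    - ∫ w, totalReward Dmax α p (rewardLaw N L he) S w (c w) ∂outcomeLaw p (rewardLaw N L he)

theorem integral_totalReward {e : ℝ} (he : |e| ≤ 1 / 4) (S : Finset (Fin (N + 2)))
    (c : Outcome (N + 2) (L + 1) → Assignment (N + 2) (L + 1)) :
    ∫ w, totalReward Dmax α p (rewardLaw N L he) S w (c w) ∂outcomeLaw p (rewardLaw N L he)
      = (1 - α S.card) * ∫ w, grossReward Dmax p (rewardLaw N L he) S w (c w)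
          ∂outcomeLaw p (rewardLaw N L he) := by
  unfold totalReward
  rw [integral_const_mul]

/-- A pointwise loss of `d` on an event is a loss of `d` times its probability, up to overhead. -/
theorem le_gap_of_le_hTotal_sub (hp : ∀ m d, p m d ≠ 0 → 1 ≤ d ∧ d ≤ Dmax) {e : ℝ}
    (he : |e| ≤ 1 / 4) {S : Finset (Fin (N + 2))} (hS : S.card ≤ I) (hα : α S.card ≤ 1)
    {c : Outcome (N + 2) (L + 1) → Assignment (N + 2) (L + 1)}
    (hc : ∀ C, MeasurableSet {w | c w = C}) {E : Set (Outcome (N + 2) (L + 1))}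
    (hE : MeasurableSet E) {d : ℝ}
    (h : ∀ w, Typical w → w ∈ E → grossReward Dmax p (rewardLaw N L he) S w (c w) + d
      ≤ hTotal Dmax p (rewardLaw N L he) S w) :
    (1 - α S.card) * (d * (outcomeLaw p (rewardLaw N L he)).real E)
      ≤ gap Dmax I α p he S c := by
  have h1 := probingValue_le_optimalValue Dmax α p (rewardLaw N L he) hS
  have hi := integrable_grossReward hp he S hc
  have hj : Integrable (E.indicator fun _ => d) (outcomeLaw p (rewardLaw N L he)) :=
    (integrable_const d).indicator hE
  have h2 : ∫ w, (grossReward Dmax p (rewardLaw N L he) S w (c w) + E.indicator (fun _ => d) w)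
        ∂outcomeLaw p (rewardLaw N L he)
      ≤ ∫ w, hTotal Dmax p (rewardLaw N L he) S w ∂outcomeLaw p (rewardLaw N L he) := by
    refine integral_mono_ae (hi.add hj) (integrable_hTotal hp he S) ?_
    filter_upwards [ae_typical hp he] with w hw
    by_cases hwE : w ∈ E
    · simpa [Set.indicator_of_mem hwE] using h w hw hwE
    · simpa [Set.indicator_of_notMem hwE] using
        grossReward_le_hTotal Dmax p (rewardLaw N L he) S w (c w)
  rw [integral_add hi hj, integral_indicator_const _ hE, smul_eq_mul] at h2
  have h3 := mul_le_mul_of_nonneg_left h2 (sub_nonneg.2 hα)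
  unfold probingValue at h1
  rw [gap, integral_totalReward]
  linarith

theorem gap_nonneg (hp : ∀ m d, p m d ≠ 0 → 1 ≤ d ∧ d ≤ Dmax) {e : ℝ}
    (he : |e| ≤ 1 / 4) {S : Finset (Fin (N + 2))} (hS : S.card ≤ I) (hα : α S.card ≤ 1)
    {c : Outcome (N + 2) (L + 1) → Assignment (N + 2) (L + 1)}
    (hc : ∀ C, MeasurableSet {w | c w = C}) : 0 ≤ gap Dmax I α p he S c := by
  simpa using le_gap_of_le_hTotal_sub hp he hS hα hc MeasurableSet.empty (d := 0)
    (fun w _ hw => absurd hw (Set.notMem_empty w))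

/-- Probing with a large overhead is worse than not probing. -/
theorem le_gap_of_overhead (hp : ∀ m d, p m d ≠ 0 → 1 ≤ d ∧ d ≤ Dmax) {e : ℝ}
    (he : |e| ≤ 1 / 4) (hα0 : α 0 = 0) {S : Finset (Fin (N + 2))} (hα : α S.card ≤ 1)
    (hα' : 3 / 4 ≤ α S.card)
    {c : Outcome (N + 2) (L + 1) → Assignment (N + 2) (L + 1)}
    (hc : ∀ C, MeasurableSet {w | c w = C}) : 1 / 4 ≤ gap Dmax I α p he S c := by
  have h1 := probingValue_le_optimalValue Dmax α p (rewardLaw N L he) (S := ∅) (I := I) (by simp)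
  -- Without probing, arm `1` yields 1/2 whatever the bias, against at most `1 - 3/4` after the
  -- overhead.
  have h2 : 1 / 2 ≤ ∫ w, hTotal Dmax p (rewardLaw N L he) ∅ w
      ∂outcomeLaw p (rewardLaw N L he) := by
    calc (1 / 2 : ℝ) = ∫ _, (1 / 2 : ℝ) ∂outcomeLaw p (rewardLaw N L he) := by simp
      _ ≤ _ := by
        refine integral_mono_ae (integrable_const _) (integrable_hTotal hp he ∅) ?_
        filter_upwards [ae_typical hp he] with w hw
        refine le_trans (le_of_eq ?_)
          (grossReward_le_hTotal Dmax p (rewardLaw N L he) ∅ w fun _ => some 1)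
        rw [grossReward_eq hp he ∅ hw]
        simp [mean_rewardLaw_succ he (m := (1 : Fin (N + 2))) (by simp)]
  have h3 : ∫ w, grossReward Dmax p (rewardLaw N L he) S w (c w)
      ∂outcomeLaw p (rewardLaw N L he) ≤ 1 := by
    calc _ ≤ ∫ _, (1 : ℝ) ∂outcomeLaw p (rewardLaw N L he) := by
          refine integral_mono_ae (integrable_grossReward hp he S hc) (integrable_const _) ?_
          filter_upwards [ae_typical hp he] with w hw
          exact (grossReward_mem_Icc hp he S hw (c w)).2
      _ = 1 := by simp
  unfold probingValue at h1
  rw [gap, integral_totalReward]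
  rw [Finset.card_empty, hα0] at h1
  have h4 := mul_le_mul_of_nonneg_left h3 (sub_nonneg.2 hα)
  linarith

/-- Probing the arm with the `coin` law is worse than probing another arm in its place. -/
theorem le_gap_of_zero_mem (hp : ∀ m d, p m d ≠ 0 → 1 ≤ d ∧ d ≤ Dmax) {e : ℝ}
    (he : |e| ≤ 1 / 4) {S : Finset (Fin (N + 2))} (hS : S.card ≤ I) (hα : α S.card ≤ 1)
    (h0 : 0 ∈ S) (hne : S ≠ Finset.univ)
    {c : Outcome (N + 2) (L + 1) → Assignment (N + 2) (L + 1)}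
    (hc : ∀ C, MeasurableSet {w | c w = C}) :
    (1 - α S.card) * ((3 / 4) ^ (N + 1) / 32) ≤ gap Dmax I α p he S c := by
  obtain ⟨m₁, hm₁⟩ : ∃ m, m ∉ S := by
    by_contra! h
    exact hne (Finset.eq_univ_iff_forall.2 h)
  -- `S'` exchanges the coin arm for the unprobed arm `m₁`. It has the size of `S`, so the overhead
  -- is a common factor.
  set A := S.erase 0 with hA
  set S' := insert m₁ A with hS'
  have hm₁A : m₁ ∉ A := fun h => hm₁ (Finset.mem_of_mem_erase h)
  have hm₁0 : m₁ ≠ 0 := fun h => hm₁ (h ▸ h0)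
  have hA0 : 0 ∉ A := Finset.notMem_erase 0 S
  have hS'0 : 0 ∉ S' := by
    rw [hS', Finset.mem_insert, not_or]
    exact ⟨hm₁0.symm, hA0⟩
  have hAc : A.card + 1 = S.card := Finset.card_erase_add_one h0
  have hS'c : S'.card = A.card + 1 := Finset.card_insert_of_notMem hm₁A
  have hAN : A.card ≤ N + 1 := by
    have := Finset.card_le_univ S
    rw [Fintype.card_fin] at this
    omega
  have hB : MeasurableSet ({1}ᶜ : Set ℝ) := (measurableSet_singleton _).compl
  have hEm : ∀ A : Finset (Fin (N + 2)),
      MeasurableSet {w : Outcome (N + 2) (L + 1) | ∀ m ∈ A, w.2 m 0 ∈ ({1}ᶜ : Set ℝ)} := by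
    intro A
    have : {w : Outcome (N + 2) (L + 1) | ∀ m ∈ A, w.2 m 0 ∈ ({1}ᶜ : Set ℝ)}
        = ⋂ m ∈ A, (fun w => w.2 m 0) ⁻¹' ({1}ᶜ : Set ℝ) := by
      ext w; simp
    rw [this]
    exact A.measurableSet_biInter fun m _ => (by fun_prop : Measurable _) hB
  have hEr : ∀ A : Finset (Fin (N + 2)), 0 ∉ A → (outcomeLaw p (rewardLaw N L he)).real
      {w | ∀ m ∈ A, w.2 m 0 ∈ ({1}ᶜ : Set ℝ)} = (3 / 4) ^ A.card := fun A hA => by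
    rw [outcomeLaw_real_forall_mem p he hA hB, ternary_real_ne_one]
  have hint : ∀ (A : Finset (Fin (N + 2))) (b : ℝ), 0 ∉ A →
      Integrable (fun w => 1 - Set.indicator {w : Outcome (N + 2) (L + 1) |
        ∀ m ∈ A, w.2 m 0 ∈ ({1}ᶜ : Set ℝ)} (fun _ => b) w) (outcomeLaw p (rewardLaw N L he)) ∧
      ∫ w, (1 - Set.indicator {w | ∀ m ∈ A, w.2 m 0 ∈ ({1}ᶜ : Set ℝ)} (fun _ => b) w)
        ∂outcomeLaw p (rewardLaw N L he) = 1 - (3 / 4) ^ A.card * b := fun A b hA => by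
    have hi : Integrable (Set.indicator {w : Outcome (N + 2) (L + 1) |
        ∀ m ∈ A, w.2 m 0 ∈ ({1}ᶜ : Set ℝ)} (fun _ => b)) (outcomeLaw p (rewardLaw N L he)) :=
      (integrable_const b).indicator (hEm A)
    refine ⟨(integrable_const 1).sub hi, ?_⟩
    rw [integral_sub (integrable_const 1) hi, integral_indicator_const _ (hEm A), hEr A hA]
    simp
  -- Strategy after probing `S'`: take an arm that shows 1; if there is none, fall back on the
  -- unprobed coin arm, with mean `1/2 + e/8`.
  have hlow : 1 - (3 / 4) ^ S'.card * (1 - (1 / 2 + e / 8))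
      ≤ ∫ w, hTotal Dmax p (rewardLaw N L he) S' w ∂outcomeLaw p (rewardLaw N L he) := by
    rw [← (hint S' _ hS'0).2]
    refine integral_mono_ae (hint S' _ hS'0).1 (integrable_hTotal hp he S') ?_
    filter_upwards [ae_typical hp he] with w hw
    by_cases hwE : ∀ m ∈ S', w.2 m 0 ∈ ({1}ᶜ : Set ℝ)
    · rw [Set.indicator_of_mem (by exact hwE)]
      refine le_trans (le_of_eq ?_)
        (grossReward_le_hTotal Dmax p (rewardLaw N L he) S' w fun _ => some 0)
      rw [grossReward_eq hp he S' hw]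
      simp [hS'0, mean_rewardLaw_zero_zero he]
    · rw [Set.indicator_of_notMem (by exact hwE)]
      obtain ⟨m, hm, h1⟩ : ∃ m ∈ S', w.2 m 0 = 1 := by simpa using hwE
      refine le_trans (le_of_eq ?_)
        (grossReward_le_hTotal Dmax p (rewardLaw N L he) S' w fun _ => some m)
      rw [grossReward_eq hp he S' hw]
      simp [hm, h1]
  -- If no ternary arm in `S` shows 1, nothing available exceeds `9/16 = 1 - 7/16`.
  have hupp : ∫ w, grossReward Dmax p (rewardLaw N L he) S w (c w)
      ∂outcomeLaw p (rewardLaw N L he) ≤ 1 - (3 / 4) ^ A.card * (7 / 16) := by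
    rw [← (hint A _ hA0).2]
    refine integral_mono_ae (integrable_grossReward hp he S hc) (hint A _ hA0).1 ?_
    filter_upwards [ae_typical hp he] with w hw
    by_cases hwE : ∀ m ∈ A, w.2 m 0 ∈ ({1}ᶜ : Set ℝ)
    · rw [Set.indicator_of_mem (by exact hwE), grossReward_eq hp he S hw]
      cases c w 0 with
      | none => norm_num
      | some m =>
        simp only [Option.elim_some]
        split_ifs with hm
        · by_cases hm0 : m = 0
          · subst hm0
            rcases hw.zero with h | h <;> rw [h] <;> norm_num
          · have h1 : w.2 m 0 ≠ 1 := hwE m (Finset.mem_erase.2 ⟨hm0, hm⟩)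
            rcases hw.succ m hm0 with h | h | h
            · rw [h]; norm_num
            · rw [h]; norm_num
            · exact absurd h h1
        · have := (mean_rewardLaw_mem (L := L) he m).2
          linarith
    · rw [Set.indicator_of_notMem (by exact hwE)]
      simpa using (grossReward_mem_Icc hp he S hw (c w)).2
  have hopt := probingValue_le_optimalValue Dmax α p (rewardLaw N L he) (S := S') (I := I)
    (by omega)
  unfold probingValue at hopt
  rw [show S'.card = S.card by omega] at hopt
  rw [gap, integral_totalReward]
  refine le_trans ?_ (sub_le_sub_right hopt _)
  rw [← mul_sub]
  refine mul_le_mul_of_nonneg_left ?_ (sub_nonneg.2 hα)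
  refine le_trans ?_ (sub_le_sub hlow hupp)
  rw [hS'c, pow_succ _ A.card]
  have hpow : (3 / 4 : ℝ) ^ (N + 1) ≤ (3 / 4) ^ A.card :=
    pow_le_pow_of_le_one (by norm_num) (by norm_num) hAN
  have hpos : (0 : ℝ) < (3 / 4) ^ A.card := by positivity
  -- The difference is `(3/4)^|A|` times `7/16 - (3/4)(1/2 - e/8) = 1/16 + 3e/32`, which is at least
  -- `5/128 > 1/32` for `e ≥ -1/4`.
  obtain ⟨e1, e2⟩ := abs_le.1 he
  nlinarith

theorem Typical.sq_eq_one {w : Outcome (N + 2) (L + 1)} (hw : Typical w) :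
    (16 * (w.2 0 0 - 1 / 2)) ^ 2 = 1 := by
  rcases hw.zero with h | h <;> rw [h] <;> norm_num

/-- The density with respect to the unbiased round is at least `1 - 2η`. Events of the current round
can thus be measured under one common law for both signs, at the price of a constant factor. -/
theorem mul_real_le_outcomeLaw_real (hp : ∀ m d, p m d ≠ 0 → 1 ≤ d ∧ d ≤ Dmax) {e η : ℝ}
    (he : |e| ≤ 1 / 4) (heη : |e| ≤ η) (hη : η ≤ 1 / 4) (h0 : |(0 : ℝ)| ≤ 1 / 4)
    (E : Set (Outcome (N + 2) (L + 1))) (hE : MeasurableSet E) :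
    (1 - 2 * η) * (outcomeLaw p (rewardLaw N L h0)).real E
      ≤ (outcomeLaw p (rewardLaw N L he)).real E := by
  have h : ENNReal.ofReal (1 - 2 * η) * outcomeLaw p (rewardLaw N L h0) E
      ≤ outcomeLaw p (rewardLaw N L he) E := by
    rw [outcomeLaw_eq_withDensity p he h0, withDensity_apply _ hE, ← setLIntegral_const]
    refine setLIntegral_mono_ae (by fun_prop) ?_
    filter_upwards [ae_typical hp h0] with w hw _
    refine ENNReal.ofReal_le_ofReal ?_
    obtain ⟨e1, e2⟩ := abs_le.1 heη
    rcases hw.zero with h | h <;> rw [h] <;> linarith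
  have h' := ENNReal.toReal_mono (measure_ne_top _ _) h
  rwa [ENNReal.toReal_mul, ENNReal.toReal_ofReal (by linarith)] at h'

/-- If the `coin` arm is not probed, no assignment rule does well for both signs of the bias. -/
theorem le_gap_add_gap_of_zero_notMem (hp : ∀ m d, p m d ≠ 0 → 1 ≤ d ∧ d ≤ Dmax) {η : ℝ}
    (hη0 : 0 ≤ η) (hη : |η| ≤ 1 / 4) (hη' : |-η| ≤ 1 / 4) {S : Finset (Fin (N + 2))}
    (hS : S.card ≤ I) (hα : α S.card ≤ 1) (h0 : 0 ∉ S)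
    {c : Outcome (N + 2) (L + 1) → Assignment (N + 2) (L + 1)}
    (hc : ∀ C, MeasurableSet {w | c w = C}) :
    (1 - α S.card) * (η / 16 * (1 / 2) ^ (N + 1))
      ≤ gap Dmax I α p hη S c + gap Dmax I α p hη' S c := by
  have hz : |(0 : ℝ)| ≤ 1 / 4 := by norm_num
  have hη4 : η ≤ 1 / 4 := (le_abs_self η).trans hη
  set A : Finset (Fin (N + 2)) := Finset.univ.erase 0 with hA
  have hA0 : 0 ∉ A := Finset.notMem_erase _ _
  have hAc : A.card = N + 1 := by simp [hA]
  set E : Set (Outcome (N + 2) (L + 1)) := {w | ∀ m ∈ A, w.2 m 0 ∈ ({1 / 2} : Set ℝ)} with hE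
  set F : Set (Outcome (N + 2) (L + 1)) := {w | c w 0 = some 0} with hF
  have hEm : MeasurableSet E := by
    have : E = ⋂ m ∈ A, (fun w => w.2 m 0) ⁻¹' ({1 / 2} : Set ℝ) := by
      ext w; simp [hE]
    rw [this]
    exact A.measurableSet_biInter fun m _ =>
      (by fun_prop : Measurable _) (measurableSet_singleton _)
  have hFm : MeasurableSet F :=
    measurableSet_comp_fiber hc (g := fun C _ => C 0) (c := some 0)
      fun C => MeasurableSet.const _
  have hEhalf : ∀ w ∈ E, ∀ m, m ≠ 0 → w.2 m 0 = 1 / 2 := fun w hw m hm =>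
    hw m (Finset.mem_erase.2 ⟨hm, Finset.mem_univ _⟩)
  -- On `E` every arm but `0` is worth 1/2, probed or not. With positive bias, avoiding arm `0` (off
  -- `F`) loses `η/8`; with negative bias, choosing it (on `F`) does.
  have hplus := le_gap_of_le_hTotal_sub hp hη hS hα hc (hEm.diff hFm) (d := η / 8) (by
    intro w hw hwE
    refine le_trans ?_
      (grossReward_le_hTotal Dmax p (rewardLaw N L hη) S w fun _ => some 0)
    rw [grossReward_eq hp hη S hw, grossReward_eq hp hη S hw]
    simp only [Option.elim_some, h0, if_false, mean_rewardLaw_zero_zero hη]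
    have hwF : c w 0 ≠ some 0 := hwE.2
    cases hcw : c w 0 with
    | none => simp only [Option.elim_none]; linarith
    | some m =>
      have hm : m ≠ 0 := fun h => hwF (h ▸ hcw)
      simp only [Option.elim_some, hEhalf w hwE.1 m hm, mean_rewardLaw_succ hη hm, ite_self]
      linarith)
  have hminus := le_gap_of_le_hTotal_sub hp hη' hS hα hc (hEm.inter hFm) (d := η / 8) (by
    intro w hw hwE
    refine le_trans ?_
      (grossReward_le_hTotal Dmax p (rewardLaw N L hη') S w fun _ => some 1)
    have h1 : (1 : Fin (N + 2)) ≠ 0 := by simp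
    have hwF : c w 0 = some 0 := hwE.2
    rw [grossReward_eq hp hη' S hw, grossReward_eq hp hη' S hw, hwF]
    simp only [Option.elim_some, h0, if_false, mean_rewardLaw_zero_zero hη',
      hEhalf w hwE.1 1 h1, mean_rewardLaw_succ hη' h1, ite_self]
    linarith)
  have hp1 := mul_real_le_outcomeLaw_real hp hη (abs_of_nonneg hη0).le hη4 hz (E \ F)
    (hEm.diff hFm)
  have hp2 := mul_real_le_outcomeLaw_real hp hη' (by rw [abs_neg, abs_of_nonneg hη0]) hη4 hz
    (E ∩ F) (hEm.inter hFm)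
  -- Under the unbiased law the two losing events partition `E`, of probability `(1/2)^(N+1)`,
  -- whatever the rule `c`.
  have hsum := measureReal_inter_add_sdiff (μ := outcomeLaw p (rewardLaw N L hz)) (s := E) hFm
  rw [hE, outcomeLaw_real_forall_mem p hz hA0 (measurableSet_singleton _), ternary_real_half,
    hAc, ← hE] at hsum
  refine le_trans ?_ (add_le_add hplus hminus)
  rw [← mul_add]
  refine mul_le_mul_of_nonneg_left ?_ (sub_nonneg.2 hα)
  have hpow : (0 : ℝ) < (1 / 2) ^ (N + 1) := by positivity
  have h2 : (1 - 2 * η) * (1 / 2) ^ (N + 1) ≤ (outcomeLaw p (rewardLaw N L hη)).real (E \ F)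
      + (outcomeLaw p (rewardLaw N L hη')).real (E ∩ F) := by
    rw [← hsum]
    linarith
  have h3 : 1 / 2 * (1 / 2 : ℝ) ^ (N + 1) ≤ (1 - 2 * η) * (1 / 2) ^ (N + 1) :=
    mul_le_mul_of_nonneg_right (by linarith) hpow.le
  have h4 := mul_le_mul_of_nonneg_left (h3.trans h2) (by positivity : 0 ≤ η / 8)
  linarith

/-- Large overhead or a probed coin arm costs a constant, which dominates since `η ≤ 1/4`. The
remaining case fixes the 64: the factor `1 - α > 1/4` times `η/16`. -/
theorem le_gap_add_gap (hp : ∀ m d, p m d ≠ 0 → 1 ≤ d ∧ d ≤ Dmax) (hI : I ≤ N + 2)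
    (hα0 : α 0 = 0) (hαI : α I = 1) (hmono : ∀ i j, i ≤ j → j ≤ I → α i ≤ α j) {η : ℝ}
    (hη0 : 0 ≤ η) (hη : |η| ≤ 1 / 4) (hη' : |-η| ≤ 1 / 4) {S : Finset (Fin (N + 2))}
    (hS : S.card ≤ I)
    {c : Outcome (N + 2) (L + 1) → Assignment (N + 2) (L + 1)}
    (hc : ∀ C, MeasurableSet {w | c w = C}) :
    (1 / 2) ^ (N + 1) / 64 * η ≤ gap Dmax I α p hη S c + gap Dmax I α p hη' S c := by
  have hα : α S.card ≤ 1 := hαI ▸ hmono _ _ hS le_rfl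
  have hη4 : η ≤ 1 / 4 := (le_abs_self η).trans hη
  have hg := gap_nonneg hp hη hS hα hc
  have hg' := gap_nonneg hp hη' hS hα hc
  have hpow0 : (0 : ℝ) < (1 / 2) ^ (N + 1) := by positivity
  have hpow1 : (1 / 2 : ℝ) ^ (N + 1) ≤ 1 := pow_le_one₀ (by norm_num) (by norm_num)
  have hpow2 : (1 / 2 : ℝ) ^ (N + 1) ≤ (3 / 4) ^ (N + 1) :=
    pow_le_pow_left₀ (by norm_num) (by norm_num) _
  by_cases hbig : 3 / 4 ≤ α S.card
  · have := le_gap_of_overhead (I := I) hp hη hα0 hα hbig hc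
    nlinarith
  · push Not at hbig
    by_cases h0 : 0 ∈ S
    -- Probing all arms forces `I = N + 2`, hence overhead 1, which the case assumption excludes.
    · have hne : S ≠ Finset.univ := by
        rintro rfl
        rw [Finset.card_univ, Fintype.card_fin] at hS hbig
        rw [le_antisymm hS hI, hαI] at hbig
        norm_num at hbig
      have := le_gap_of_zero_mem hp hη hS hα h0 hne hc
      nlinarith
    · have := le_gap_add_gap_of_zero_notMem hp hη0 hη hη' hS hα h0 hc
      have h1 : 0 ≤ η / 16 * (1 / 2 : ℝ) ^ (N + 1) := by positivity
      nlinarith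

end Gap

/-! ### From one round to the regret over all rounds -/

section Rounds

/-- Singling out one of `n + 1` independent coordinates. -/
theorem measurePreserving_insertNth {Ω Seed : Type*} [MeasurableSpace Ω] [MeasurableSpace Seed]
    (ρ : Measure Seed) [IsProbabilityMeasure ρ] (Q : Measure Ω) [IsProbabilityMeasure Q] {n : ℕ}
    (t : Fin (n + 1)) :
    MeasurePreserving
      (fun z : (Seed × (Fin n → Ω)) × Ω => (z.1.1, (t.insertNth z.2 z.1.2 : Fin (n + 1) → Ω)))
      ((ρ.prod (Measure.pi fun _ => Q)).prod Q) (ρ.prod (Measure.pi fun _ => Q)) :=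
  ((MeasurePreserving.id ρ).prod
    (((measurePreserving_piFinSuccAbove (fun _ : Fin (n + 1) => Q) t).symm).comp
      Measure.measurePreserving_swap)).comp (measurePreserving_prodAssoc ρ _ Q)

variable {N L Dmax I : ℕ} {p : Fin (N + 2) → PMF ℕ} {α : ℕ → ℝ}
variable {Seed : Type*} [MeasurableSpace Seed]

/-- The history in round `t` when the other rounds are `x.2` and the randomness is `x.1`. -/
noncomputable def OnlineAlgorithm.pastHistory (A : OnlineAlgorithm (N + 2) (L + 1) I Seed) {e : ℝ}
    (he : |e| ≤ 1 / 4) {n : ℕ} (t : Fin (n + 1))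
    (x : Seed × (Fin n → Outcome (N + 2) (L + 1))) : Fin t → Feedback (N + 2) (L + 1) :=
  A.history (rewardLaw N L he) x.1 t fun i => x.2 (Fin.castLE (Nat.le_of_lt_succ t.isLt) i)

/-- The loss in round `t`, given the internal randomness and the other rounds. -/
noncomputable def OnlineAlgorithm.roundGap (A : OnlineAlgorithm (N + 2) (L + 1) I Seed)
    (Dmax : ℕ) (α : ℕ → ℝ) (p : Fin (N + 2) → PMF ℕ) {e : ℝ} (he : |e| ≤ 1 / 4) {n : ℕ}
    (t : Fin (n + 1)) (x : Seed × (Fin n → Outcome (N + 2) (L + 1))) : ℝ :=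
  gap Dmax I α p he (A.probe t x.1 (A.pastHistory he t x)) (A.action t x.1 (A.pastHistory he t x))

/-- Makes the probing set and the assignment rule of the round identical for both signs, so that
`le_gap_add_gap` applies pointwise. -/
theorem OnlineAlgorithm.pastHistory_eq (A : OnlineAlgorithm (N + 2) (L + 1) I Seed) {e e' : ℝ}
    (he : |e| ≤ 1 / 4) (he' : |e'| ≤ 1 / 4) {n : ℕ} (t : Fin (n + 1))
    (x : Seed × (Fin n → Outcome (N + 2) (L + 1))) :
    A.pastHistory he t x = A.pastHistory he' t x :=
  A.history_congr (mean_rewardLaw_lt_iff he he') _ _ _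

theorem OnlineAlgorithm.reward_insertNth (A : OnlineAlgorithm (N + 2) (L + 1) I Seed) {e : ℝ}
    (he : |e| ≤ 1 / 4) {n : ℕ} (t : Fin (n + 1))
    (x : Seed × (Fin n → Outcome (N + 2) (L + 1))) (w : Outcome (N + 2) (L + 1)) :
    A.reward Dmax α p (rewardLaw N L he) x.1 (t.insertNth w x.2 : Fin (n + 1) → _) t
      = totalReward Dmax α p (rewardLaw N L he) (A.probe t x.1 (A.pastHistory he t x)) w
          (A.action t x.1 (A.pastHistory he t x) w) := by
  have h : (fun i : Fin t => (t.insertNth w x.2 : Fin (n + 1) → Outcome (N + 2) (L + 1))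
      (Fin.castLE t.isLt.le i))
      = fun i => x.2 (Fin.castLE (Nat.le_of_lt_succ t.isLt) i) := by
    funext i
    -- Rounds before `t` keep their index when the outcome of round `t` is inserted.
    have : Fin.castLE t.isLt.le i
        = t.succAbove (Fin.castLE (Nat.le_of_lt_succ t.isLt) i) := by
      rw [Fin.succAbove_of_castSucc_lt _ _ (by simp [Fin.lt_def])]
      ext
      simp
    rw [this, Fin.insertNth_apply_succAbove]
  unfold reward pastHistory
  simp only [h, Fin.insertNth_apply_same]

theorem OnlineAlgorithm.measurableSet_action_fiber (A : OnlineAlgorithm (N + 2) (L + 1) I Seed)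
    (t : ℕ) (u : Seed) (h : Fin t → Feedback (N + 2) (L + 1)) (C : Assignment (N + 2) (L + 1)) :
    MeasurableSet {w | A.action t u h w = C} :=
  A.measurableSet_action t measurable_const measurable_const measurable_id C

theorem abs_totalReward_le (hp : ∀ m d, p m d ≠ 0 → 1 ≤ d ∧ d ≤ Dmax) (hα0 : α 0 = 0)
    (hαI : α I = 1) (hmono : ∀ i j, i ≤ j → j ≤ I → α i ≤ α j) {e : ℝ} (he : |e| ≤ 1 / 4)
    {S : Finset (Fin (N + 2))} (hS : S.card ≤ I) {w : Outcome (N + 2) (L + 1)} (hw : Typical w)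
    (C : Assignment (N + 2) (L + 1)) :
    |totalReward Dmax α p (rewardLaw N L he) S w C| ≤ 1 := by
  obtain ⟨h1, h2⟩ := grossReward_mem_Icc hp he S hw C
  have h3 : α S.card ≤ 1 := hαI ▸ hmono _ _ hS le_rfl
  have h4 : 0 ≤ α S.card := hα0 ▸ hmono _ _ (Nat.zero_le _) hS
  unfold totalReward
  rw [abs_of_nonneg (mul_nonneg (by linarith) h1)]
  exact mul_le_one₀ (by linarith) h1 h2

theorem OnlineAlgorithm.integrable_reward (hp : ∀ m d, p m d ≠ 0 → 1 ≤ d ∧ d ≤ Dmax)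
    (hα0 : α 0 = 0) (hαI : α I = 1) (hmono : ∀ i j, i ≤ j → j ≤ I → α i ≤ α j)
    (ρ : Measure Seed) [IsProbabilityMeasure ρ] (A : OnlineAlgorithm (N + 2) (L + 1) I Seed)
    {e : ℝ} (he : |e| ≤ 1 / 4) {T : ℕ} (t : Fin T) :
    Integrable (fun x : Seed × (Fin T → Outcome (N + 2) (L + 1)) =>
      A.reward Dmax α p (rewardLaw N L he) x.1 x.2 t) (runLaw ρ p (rewardLaw N L he) T) := by
  unfold runLaw
  refine Integrable.of_bound (A.measurable_reward Dmax α p _ t).aestronglyMeasurable 1 ?_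
  have hq : Measure.QuasiMeasurePreserving
      (fun x : Seed × (Fin T → Outcome (N + 2) (L + 1)) => x.2 t)
      (ρ.prod (Measure.pi fun _ => outcomeLaw p (rewardLaw N L he)))
      (outcomeLaw p (rewardLaw N L he)) :=
    (Measure.quasiMeasurePreserving_eval _ t).comp Measure.quasiMeasurePreserving_snd
  filter_upwards [hq.ae (ae_typical hp he)] with x hx
  exact abs_totalReward_le hp hα0 hαI hmono he (A.card_probe_le _ _ _) hx _

/-- Fubini: the outcome of round `t` is independent of the seed and the other rounds, which
determine the probing set and the assignment rule, so it can be integrated out first. -/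
theorem OnlineAlgorithm.integral_roundGap (hp : ∀ m d, p m d ≠ 0 → 1 ≤ d ∧ d ≤ Dmax)
    (hα0 : α 0 = 0) (hαI : α I = 1) (hmono : ∀ i j, i ≤ j → j ≤ I → α i ≤ α j)
    (ρ : Measure Seed) [IsProbabilityMeasure ρ] (A : OnlineAlgorithm (N + 2) (L + 1) I Seed)
    {e : ℝ} (he : |e| ≤ 1 / 4) {n : ℕ} (t : Fin (n + 1)) :
    Integrable (A.roundGap Dmax α p he t)
        (ρ.prod (Measure.pi fun _ => outcomeLaw p (rewardLaw N L he))) ∧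
      ∫ x, A.roundGap Dmax α p he t x
          ∂(ρ.prod (Measure.pi fun _ => outcomeLaw p (rewardLaw N L he)))
        = optimalValue Dmax I α p (rewardLaw N L he)
          - ∫ x, A.reward Dmax α p (rewardLaw N L he) x.1 x.2 t
              ∂runLaw ρ p (rewardLaw N L he) (n + 1) := by
  have hmp := measurePreserving_insertNth ρ (outcomeLaw p (rewardLaw N L he)) t
  have hr := A.integrable_reward hp hα0 hαI hmono ρ he t
  unfold runLaw at hr ⊢
  have hi := hmp.integrable_comp_of_integrable hr
  have hrw : (fun x : Seed × (Fin n → Outcome (N + 2) (L + 1)) => A.roundGap Dmax α p he t x)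
      = fun x => optimalValue Dmax I α p (rewardLaw N L he)
        - ∫ w, A.reward Dmax α p (rewardLaw N L he) x.1
            (t.insertNth w x.2 : Fin (n + 1) → _) t ∂outcomeLaw p (rewardLaw N L he) := by
    funext x
    simp only [A.reward_insertNth he t x]
    rfl
  have hl := hi.integral_prod_left
  have hI : ∫ x, A.reward Dmax α p (rewardLaw N L he) x.1 x.2 t
      ∂(ρ.prod (Measure.pi fun _ => outcomeLaw p (rewardLaw N L he)))
      = ∫ x : Seed × (Fin n → Outcome (N + 2) (L + 1)),
        ∫ w, A.reward Dmax α p (rewardLaw N L he) x.1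
          (t.insertNth w x.2 : Fin (n + 1) → _) t ∂outcomeLaw p (rewardLaw N L he)
          ∂(ρ.prod (Measure.pi fun _ => outcomeLaw p (rewardLaw N L he))) := by
    have h1 := integral_map hmp.measurable.aemeasurable
      (by rw [hmp.map_eq]; exact hr.aestronglyMeasurable)
    rw [hmp.map_eq] at h1
    rw [h1]
    exact integral_prod (μ := ρ.prod (Measure.pi fun _ : Fin n =>
        outcomeLaw p (rewardLaw N L he))) (fun z => A.reward Dmax α p (rewardLaw N L he) z.1.1
          (t.insertNth z.2 z.1.2 : Fin (n + 1) → _) t) hi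
  constructor
  · change Integrable (fun x => A.roundGap Dmax α p he t x) _
    rw [hrw]
    exact (integrable_const _).sub hl
  · rw [hrw, hI]
    refine (integral_sub (integrable_const _) hl).trans ?_
    simp

theorem OnlineAlgorithm.integral_regret (hp : ∀ m d, p m d ≠ 0 → 1 ≤ d ∧ d ≤ Dmax)
    (hα0 : α 0 = 0) (hαI : α I = 1) (hmono : ∀ i j, i ≤ j → j ≤ I → α i ≤ α j)
    (ρ : Measure Seed) [IsProbabilityMeasure ρ] (A : OnlineAlgorithm (N + 2) (L + 1) I Seed)
    {e : ℝ} (he : |e| ≤ 1 / 4) (n : ℕ) :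
    Integrable (A.regret Dmax α p (rewardLaw N L he) (n + 1))
        (runLaw ρ p (rewardLaw N L he) (n + 1)) ∧
      ∫ x, A.regret Dmax α p (rewardLaw N L he) (n + 1) x
          ∂runLaw ρ p (rewardLaw N L he) (n + 1)
        = ∑ t : Fin (n + 1), ∫ x, A.roundGap Dmax α p he t x
            ∂(ρ.prod (Measure.pi fun _ => outcomeLaw p (rewardLaw N L he))) := by
  have hprob : IsProbabilityMeasure (runLaw ρ p (rewardLaw N L he) (n + 1)) := by
    unfold runLaw
    infer_instance
  have hr := fun t : Fin (n + 1) => A.integrable_reward hp hα0 hαI hmono ρ he t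
  have hs := integrable_finsetSum Finset.univ fun t _ => hr t
  unfold regret
  refine ⟨(integrable_const _).sub hs, ?_⟩
  rw [integral_sub (integrable_const _) hs, integral_finsetSum _ fun t _ => hr t,
    Finset.sum_congr rfl fun t _ => (A.integral_roundGap hp hα0 hαI hmono ρ he t).2,
    Finset.sum_sub_distrib]
  simp

theorem OnlineAlgorithm.le_integral_regret_add (hp : ∀ m d, p m d ≠ 0 → 1 ≤ d ∧ d ≤ Dmax)
    (hI : I ≤ N + 2) (hα0 : α 0 = 0) (hαI : α I = 1)
    (hmono : ∀ i j, i ≤ j → j ≤ I → α i ≤ α j) (ρ : Measure Seed) [IsProbabilityMeasure ρ]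
    (A : OnlineAlgorithm (N + 2) (L + 1) I Seed) {η : ℝ} (hη0 : 0 ≤ η) (hη : |η| ≤ 1 / 4)
    (hη' : |-η| ≤ 1 / 4) (n : ℕ) :
    (n + 1) * ((1 / 2) ^ (N + 1) / 64 * η * (1 - (2 * η) ^ 2) ^ n / 2)
      ≤ ∫ x, A.regret Dmax α p (rewardLaw N L hη) (n + 1) x
          ∂runLaw ρ p (rewardLaw N L hη) (n + 1)
        + ∫ x, A.regret Dmax α p (rewardLaw N L hη') (n + 1) x
          ∂runLaw ρ p (rewardLaw N L hη') (n + 1) := by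
  have hz : |(0 : ℝ)| ≤ 1 / 4 := by norm_num
  have hη4 : η ≤ 1 / 4 := (le_abs_self η).trans hη
  have hα : ∀ t u h, α (A.probe t u h).card ≤ 1 := fun t u h =>
    hαI ▸ hmono _ _ (A.card_probe_le t u h) le_rfl
  rw [(A.integral_regret hp hα0 hαI hmono ρ hη n).2,
    (A.integral_regret hp hα0 hαI hmono ρ hη' n).2, ← Finset.sum_add_distrib]
  have hround : ∀ t : Fin (n + 1), (1 / 2) ^ (N + 1) / 64 * η * (1 - (2 * η) ^ 2) ^ n / 2
      ≤ ∫ x, A.roundGap Dmax α p hη t x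
          ∂(ρ.prod (Measure.pi fun _ => outcomeLaw p (rewardLaw N L hη)))
        + ∫ x, A.roundGap Dmax α p hη' t x
          ∂(ρ.prod (Measure.pi fun _ => outcomeLaw p (rewardLaw N L hη'))) := by
    intro t
    -- The observations are all `n` other rounds in full, later ones included; the extra information
    -- only strengthens the statement.
    refine two_point_bound ρ (outcomeLaw p (rewardLaw N L hz)) _ _
      (y := fun w => 16 * (w.2 0 0 - 1 / 2)) (by fun_prop)
      ((ae_typical hp hz).mono fun w hw => hw.sq_eq_one) (by positivity) (by linarith)
      (outcomeLaw_eq_withDensity p hη hz) ?_ n (by positivity)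
      (A.integral_roundGap hp hα0 hαI hmono ρ hη t).1
      (A.integral_roundGap hp hα0 hαI hmono ρ hη' t).1
      (fun x => gap_nonneg hp hη (A.card_probe_le _ _ _) (hα _ _ _)
        (A.measurableSet_action_fiber _ _ _))
      (fun x => gap_nonneg hp hη' (A.card_probe_le _ _ _) (hα _ _ _)
        (A.measurableSet_action_fiber _ _ _)) fun x => ?_
    · rw [outcomeLaw_eq_withDensity p hη' hz]
      congr 1
      funext w
      congr 1
      ring
    · unfold roundGap
      rw [A.pastHistory_eq hη' hη t x]
      exact le_gap_add_gap hp hI hα0 hαI hmono hη0 hη hη' (A.card_probe_le _ _ _)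
        (A.measurableSet_action_fiber _ _ _)
  refine le_trans (le_of_eq ?_) (Finset.sum_le_sum fun t _ => hround t)
  simp

end Rounds

end PUCS

/-! ### Choice of the bias and conclusion -/

theorem mainTheorem4 (M : ℕ) (hM : 2 ≤ M) :
    ∃ c : ℝ, 0 < c ∧
      ∀ (K Dmax I T : ℕ), 1 ≤ K → 1 ≤ I → I ≤ M → 1 ≤ T →
      ∀ α : ℕ → ℝ, α 0 = 0 → α I = 1 → (∀ i j, i ≤ j → j ≤ I → α i ≤ α j) →
      ∀ p : Fin M → PMF ℕ, (∀ m d, p m d ≠ 0 → 1 ≤ d ∧ d ≤ Dmax) →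
      ∀ (Seed : Type*) [MeasurableSpace Seed] (ρ : Measure Seed) [IsProbabilityMeasure ρ]
        (A : PUCS.OnlineAlgorithm M K I Seed),
      ∃ ν : Fin M → Fin K → ProbabilityMeasure ℝ,
        (∀ m k, (ν m k : Measure ℝ) (Set.Icc (0 : ℝ) 1)ᶜ = 0) ∧
        Integrable (A.regret Dmax α p ν T) (PUCS.runLaw ρ p ν T) ∧
        c * Real.sqrt T ≤ ∫ x, A.regret Dmax α p ν T x ∂(PUCS.runLaw ρ p ν T) := by
  obtain ⟨N, rfl⟩ := Nat.exists_eq_add_of_le' hM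
  refine ⟨(1 / 2) ^ (N + 1) / 64 * (3 / 64), by positivity, ?_⟩
  intro K Dmax I T hK _ hI hT α hα0 hαI hmono p hp Seed _ ρ _ A
  obtain ⟨L, rfl⟩ := Nat.exists_eq_add_of_le' hK
  obtain ⟨n, rfl⟩ := Nat.exists_eq_add_of_le' hT
  set s := Real.sqrt ((n + 1 : ℕ) : ℝ) with hs
  have hs2 : s ^ 2 = (n : ℝ) + 1 := by
    rw [hs, Real.sq_sqrt (Nat.cast_nonneg _)]
    push_cast
    ring
  have hs1 : 1 ≤ s := by
    rw [hs, Real.one_le_sqrt]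
    push_cast
    linarith [Nat.cast_nonneg (α := ℝ) n]
  -- The bias is `η = 1/(4√T)` with `T = n + 1`, so that `(2η)² = 1/(4T)`.
  have hη0 : 0 ≤ 1 / (4 * s) := by positivity
  have hη4 : 1 / (4 * s) ≤ 1 / 4 := one_div_le_one_div_of_le (by norm_num) (by linarith)
  have hη : |1 / (4 * s)| ≤ 1 / 4 := by rwa [abs_of_nonneg hη0]
  have hη' : |-(1 / (4 * s))| ≤ 1 / 4 := by rwa [abs_neg]
  have hsum := A.le_integral_regret_add hp hI hα0 hαI hmono ρ hη0 hη hη' n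
  -- Bernoulli's inequality: `(1 - 1/(4T))^n ≥ 1 - n/(4T) ≥ 3/4`.
  have hpow : 3 / 4 ≤ (1 - (2 * (1 / (4 * s))) ^ 2) ^ n := by
    have h1 : (2 * (1 / (4 * s))) ^ 2 = 1 / (4 * s ^ 2) := by
      field_simp
      norm_num
    have h2 : 1 / (4 * s ^ 2) ≤ 1 := by
      rw [div_le_one (by positivity)]
      nlinarith
    have h3 := one_add_mul_le_pow (a := -(1 / (4 * s ^ 2))) (by linarith) n
    have h4 : (n : ℝ) * (1 / (4 * s ^ 2)) ≤ 1 / 4 := by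
      rw [hs2, mul_one_div, div_le_div_iff₀ (by positivity) (by norm_num)]
      linarith
    rw [h1, sub_eq_add_neg]
    linarith
  -- Origin of 3/64: `T η = √T/4`, times `3/4 · 1/2` from the overlap, halved because only the
  -- larger of the two regrets is kept.
  have hlow : 2 * ((1 / 2) ^ (N + 1) / 64 * (3 / 64) * s)
      ≤ (n + 1) * ((1 / 2) ^ (N + 1) / 64 * (1 / (4 * s))
        * (1 - (2 * (1 / (4 * s))) ^ 2) ^ n / 2) := by
    have h1 : ((n : ℝ) + 1) * (1 / (4 * s)) = s / 4 := by
      rw [← hs2]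
      field_simp
    have h2 : (0 : ℝ) ≤ (1 / 2) ^ (N + 1) / 64 * (s / 4) / 2 := by positivity
    calc 2 * ((1 / 2) ^ (N + 1) / 64 * (3 / 64) * s)
        = (1 / 2) ^ (N + 1) / 64 * (s / 4) / 2 * (3 / 4) := by ring
      _ ≤ (1 / 2) ^ (N + 1) / 64 * (s / 4) / 2 * (1 - (2 * (1 / (4 * s))) ^ 2) ^ n :=
        mul_le_mul_of_nonneg_left hpow h2
      _ = _ := by
        rw [← h1]
        ring
  -- The sign of the bias is chosen after the algorithm: if the positive one gives too little
  -- regret, the negative one gives the rest of the sum.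
  rcases le_total ((1 / 2) ^ (N + 1) / 64 * (3 / 64) * s)
    (∫ x, A.regret Dmax α p (PUCS.rewardLaw N L hη) (n + 1) x
      ∂PUCS.runLaw ρ p (PUCS.rewardLaw N L hη) (n + 1)) with h | h
  · exact ⟨PUCS.rewardLaw N L hη, PUCS.rewardLaw_Icc_compl hη,
      (A.integral_regret hp hα0 hαI hmono ρ hη n).1, h⟩
  · exact ⟨PUCS.rewardLaw N L hη', PUCS.rewardLaw_Icc_compl hη',
      (A.integral_regret hp hα0 hαI hmono ρ hη' n).1, by linarith⟩
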